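/- Let $d\ge 1$ and let $\{D(k);k\ge 0\}$ be real $d\times d$ matrices describing a batch Markovian arrival process (BMAP): $D(k)\ge 0$ entrywise for $k\ge 1$, the off-diagonal entries of $D(0)$ are nonnegative, the series $D=\sum_{k\ge 0}D(k)$ converges and is an irreducible conservative generator ($De=0$, with $e$ the column vector of ones) of the background Markov chain on $\{1,\dots,d\}$, and $\sum_{k\ge 1}D(k)e\ne 0$. Consider the BMAP/M/$\infty$ queue with this arrival process and i.i.d. exponential service times of rate $\mu\in(0,\infty)$, let $L(t)$ be the number of customers in the system and $J(t)$ the phase of the BMAP at time $t$. Then $\{(L(t),J(t));t\ge 0\}$ is the continuous-time Markov chain on $\{0,1,2,\dots\}\times\{1,\dots,d\}$ whose generator $Q$ has, for $i\neq j$ or $k\ne\ell$, the rates $$q(k,i;\ell,j)=\begin{cases}D_{i,j}(\ell-k),&\ell\ge k,\\ k\mu\,\mathbf 1\{i=j\},&\ell=k-1,\\ 0,&\text{otherwise,}\end{cases}$$ and the diagonal entries $q(k,i;k,i)=D_{i,i}(0)-k\mu$. Theorem. The Markov chain $\{(L(t),J(t));t\ge 0\}$ is ergodic (that is, it has a unique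 stationary distribution $\pi$, which is positive and is the limit of $P(L(t)=\ell,J(t)=j)$ as $t\to\infty$ for every initial state) if and only if there exists a finite constant $C>0$ such that $$\sum_{k=1}^{\infty}\log(k+\mathrm e)\,D(k)\,e\le C\,e ,$$ where $\mathrm e$ is Napier's constant and the inequality is componentwise. Likewise, $Q$ has a unique stationary probability vector (a unique $\pi\ge 0$ with $\pi Q=0$ and total mass $1$) if and only if this condition holds. -/

import Mathlib

open Filter Topology MeasureTheory
open scoped ENNReal

/-- The data `{D(k); k ≥ 0}` of a batch Markovian arrival process with phases `Fin d`:
`D k i j` for `k ≥ 1` is the rate of a phase change `i → j` together with the arrival of a batch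
of size `k`, and `D 0 i j` for `i ≠ j` is the rate of a phase change without arrivals. -/
structure BMAP (d : ℕ) where
  /-- The rate matrices. -/
  D : ℕ → Matrix (Fin d) (Fin d) ℝ
  nonneg_of_pos : ∀ k, 1 ≤ k → ∀ i j, 0 ≤ D k i j
  nonneg_offDiag : ∀ i j, i ≠ j → 0 ≤ D 0 i j
  /-- The matrix `∑ₖ D(k)` converges (entrywise). -/
  summable : ∀ i j, Summable fun k => D k i j
  /-- The matrix `∑ₖ D(k)` is a conservative generator: its row sums vanish. -/
  rowSum_eq_zero : ∀ i, ∑ j, ∑' k, D k i j = 0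
  /-- The background chain, whose generator is `∑ₖ D(k)`, is irreducible. -/
  irreducible : ∀ i j, Relation.ReflTransGen (fun a b => 0 < ∑' k, D k a b) i j
  /-- There are arrivals: `∑_{k ≥ 1} D(k) e ≠ 0`. -/
  nontrivial : (fun i => ∑' k, ∑ j, D (k + 1) i j) ≠ 0

/-- The generator `Q` of the level-and-phase chain `(L(t), J(t))` of the BMAP/M/∞ queue with
service rate `μ`, on the state space `ℕ × Fin d`. -/
def BMAP.queueGenerator {d : ℕ} (A : BMAP d) (μ : ℝ) (x y : ℕ × Fin d) : ℝ :=
  if y.1 + 1 = x.1 then (if x.2 = y.2 then x.1 * μ else 0)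
  else if y.1 = x.1 then A.D 0 x.2 y.2 - (if x.2 = y.2 then x.1 * μ else 0)
  else if x.1 < y.1 then A.D (y.1 - x.1) x.2 y.2
  else 0

/-- `ctmcJumpProb q n t x y` is the probability that the continuous-time Markov chain with
generator `q`, started at `x`, makes exactly `n` jumps up to time `t` and is then at `y`
(decomposition according to the time `s` and the target `z` of the first jump). -/
noncomputable def ctmcJumpProb {S : Type*} [DecidableEq S] (q : S → S → ℝ) :
    ℕ → ℝ → S → S → ℝ≥0∞
  | 0, t, x, y => if x = y then ENNReal.ofReal (Real.exp (q x x * t)) else 0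
  | n + 1, t, x, y => ∫⁻ s in Set.Icc 0 t, ENNReal.ofReal (Real.exp (q x x * s)) *
      ∑' z, (if z = x then 0 else ENNReal.ofReal (q x z)) * ctmcJumpProb q n (t - s) z y

/-- The transition function `P(t; x, y)`, `t ≥ 0`, of the (minimal) continuous-time Markov chain
with generator `q`. -/
noncomputable def ctmcTransition {S : Type*} [DecidableEq S] (q : S → S → ℝ)
    (t : ℝ) (x y : S) : ℝ≥0∞ :=
  ∑' n, ctmcJumpProb q n t x y

/-- The probability vector `π` is a stationary distribution of the Markov chain with transition
function `P`: `π P(t) = π` for all `t ≥ 0`. -/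
def IsStationaryDistribution {S : Type*} (P : ℝ → S → S → ℝ≥0∞) (π : S → ℝ≥0∞) : Prop :=
  ∑' x, π x = 1 ∧ ∀ t, 0 ≤ t → ∀ y, ∑' x, π x * P t x y = π y

/-- A continuous-time Markov chain is ergodic: it has one and only one stationary distribution
`π`, this `π` is positive, and `P(t; x, y) → π y` as `t → ∞`, whatever the initial state `x`. -/
def IsErgodic {S : Type*} (P : ℝ → S → S → ℝ≥0∞) : Prop :=
  ∃ π : S → ℝ≥0∞, IsStationaryDistribution P π ∧
    (∀ ν, IsStationaryDistribution P ν → ν = π) ∧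
    (∀ x, 0 < π x) ∧
    ∀ x y, Tendsto (fun t => P t x y) atTop (𝓝 (π y))

/-- `π` is a stationary probability vector of the generator `q`: `π q = 0`. -/
def IsStationaryVector {S : Type*} (q : S → S → ℝ) (π : S → ℝ) : Prop :=
  (∀ x, 0 ≤ π x) ∧ HasSum π 1 ∧ ∀ y, HasSum (fun x => π x * q x y) 0

/-- The logarithmic moment condition: `∑_{k ≥ 1} log (k + e) D(k) e ≤ C e` for some finite
constant `C > 0`. -/
def BMAP.LogMomentCondition {d : ℕ} (A : BMAP d) : Prop :=
  ∃ C : ℝ, 0 < C ∧ ∀ i,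
    Summable (fun k : ℕ => Real.log (((k + 1 : ℕ) : ℝ) + Real.exp 1) * ∑ j, A.D (k + 1) i j) ∧
    ∑' k : ℕ, Real.log (((k + 1 : ℕ) : ℝ) + Real.exp 1) * ∑ j, A.D (k + 1) i j ≤ C

/-!
Everything rests on the harmonic numbers `H_k = 1 + 1/2 + ⋯ + 1/k`, since at rate `k μ` a service
lowers `H_k` by `1/k`: services change `H` at the constant rate `-μ` at every level `k ≥ 1`. As
`H_k` and `log (k + e)` are comparable, the moment condition says that `∑ₖ H_k D(k) e` is finite
(`BMAP.logMomentCondition_iff`).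

*Necessity.* A stationary distribution, of the chain or of the generator, solves the global balance
equations `IsBalanced`. For the transition function this is seen by passing to the resolvent
(`tsum_mul_resolventKernel_of_stationary`, `IsBalanced.of_resolventKernel`). Balance makes the flow
out of the levels `≤ n` equal to the flow `(n + 1) μ π(n + 1)` of services into them; division by
`n + 1` and summation over `n` give `π(0, i) ∑ₘ Hₘ (D(m) e)ᵢ ≤ μ` (`BMAP.mul_harmonicMoment_le`),
and `π(0, i) > 0` by irreducibility.

*Sufficiency.* Under the moment condition the arrivals contribute to the drift of `H` a bounded
amount, which tends to `0` at high levels (`BMAP.tendsto_arrivalDrift`). Boundedness excludes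
explosions, by the minimum principle (`tsum_resolventKernel_mul`). As the drift is at most `-μ/2`
outside a finite set, the resolvents `r (r - Q)⁻¹` keep some mass in this set as `r → 0`; a limit
point solves the balance equations (`exists_isBalanced`). The resolvent is a positive stochastic
kernel that commutes with the transition functions, so that it has one invariant distribution
(`invariant_unique`), which is stationary for the chain (`isErgodic_of_isBalanced`).

*Convergence.* The common mass of `P(t; x, ·)` and `P(t; x', ·)` increases with `t`, and its limit
is a bounded superharmonic function of `(x, x')` for two independent copies of the chain. Such a
function is constant (`superharmonic_const`), and it is `1` on the diagonal; hence the initial state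
is forgotten (`tendsto_stationary`).

The resolvent of the minimal chain is the kernel `potential`, defined without time by summing over
the number of jumps; it is the Laplace transform of `ctmcTransition`
(`lintegral_exp_mul_ctmcTransition`). All series of nonnegative terms are taken in `ℝ≥0∞`.
-/

/-! ### The potential kernel of a rate matrix -/

section Potential

variable {S : Type*} [DecidableEq S]

/-- The kernel `(w⁻¹ a)ⁿ w⁻¹`, where `w` is regarded as a diagonal matrix. -/
noncomputable def potentialTerm (w : S → ℝ≥0∞) (a : S → S → ℝ≥0∞) : ℕ → S → S → ℝ≥0∞
  | 0, x, y => if x = y then (w x)⁻¹ else 0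
  | n + 1, x, y => (w x)⁻¹ * ∑' z, a x z * potentialTerm w a n z y

/-- The kernel `∑ₙ (w⁻¹ a)ⁿ w⁻¹`, the smallest nonnegative inverse of `w - a`. If `a` holds the
jump rates of a Markov chain and `w` its exit rates increased by `r`, this is its resolvent. -/
noncomputable def potential (w : S → ℝ≥0∞) (a : S → S → ℝ≥0∞) (x y : S) : ℝ≥0∞ :=
  ∑' n, potentialTerm w a n x y

lemma tsum_ite_eq_mul (f : S → ℝ≥0∞) (c : ℝ≥0∞) (x : S) :
    ∑' z, (if x = z then c else 0) * f z = c * f x := by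
  rw [tsum_eq_single x]
  · simp
  · intro z hz
    simp [hz.symm]

lemma tsum_mul_ite_eq (f c : S → ℝ≥0∞) (y : S) :
    ∑' z, f z * (if z = y then c z else 0) = f y * c y := by
  rw [tsum_eq_single y]
  · simp
  · intro z hz
    simp [hz]

/-- The last-step decomposition of `(w⁻¹ a)ⁿ⁺¹ w⁻¹`. -/
lemma potentialTerm_succ' (w : S → ℝ≥0∞) (a : S → S → ℝ≥0∞) (n : ℕ) (x y : S) :
    potentialTerm w a (n + 1) x y = (∑' z, potentialTerm w a n x z * a z y) * (w y)⁻¹ := by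
  induction n generalizing x with
  | zero =>
    simp only [potentialTerm]
    rw [tsum_mul_ite_eq, tsum_ite_eq_mul, mul_assoc]
  | succ n ih =>
    rw [potentialTerm]
    simp_rw [ih]
    simp only [potentialTerm, ← ENNReal.tsum_mul_left, ← ENNReal.tsum_mul_right]
    rw [ENNReal.tsum_comm]
    simp only [mul_assoc]

lemma potentialTerm_transpose (w : S → ℝ≥0∞) (a : S → S → ℝ≥0∞) (n : ℕ) (x y : S) :
    potentialTerm w (fun u v => a v u) n x y = potentialTerm w a n y x := by
  induction n generalizing x with
  | zero =>
    simp only [potentialTerm, eq_comm (a := x)]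
    split_ifs with h
    · rw [h]
    · rfl
  | succ n ih =>
    rw [potentialTerm_succ' w a, potentialTerm, mul_comm]
    simp only [ih, mul_comm]

lemma potential_transpose (w : S → ℝ≥0∞) (a : S → S → ℝ≥0∞) (x y : S) :
    potential w (fun u v => a v u) x y = potential w a y x := by
  simp only [potential, potentialTerm_transpose]

variable {w : S → ℝ≥0∞} {a : S → S → ℝ≥0∞}

/-- The backward equation `w G f = f + a G f` of the potential kernel `G`. -/
lemma mul_tsum_potential (hw0 : ∀ x, w x ≠ 0) (hw : ∀ x, w x ≠ ∞) (f : S → ℝ≥0∞) (x : S) :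
    w x * ∑' y, potential w a x y * f y =
      f x + ∑' z, a x z * ∑' y, potential w a z y * f y := by
  have h : ∀ x, ∑' y, potential w a x y * f y = ∑' n, ∑' y, potentialTerm w a n x y * f y := by
    intro x
    simp only [potential, ← ENNReal.tsum_mul_right]
    rw [ENNReal.tsum_comm]
  simp only [h]
  rw [tsum_eq_zero_add' ENNReal.summable, mul_add]
  simp only [potentialTerm]
  rw [tsum_ite_eq_mul, ← mul_assoc, ENNReal.mul_inv_cancel (hw0 x) (hw x), one_mul]
  congr 1
  simp only [← ENNReal.tsum_mul_left, ← ENNReal.tsum_mul_right]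
  simp only [← mul_assoc, ENNReal.mul_inv_cancel (hw0 x) (hw x), one_mul]
  conv_rhs => rw [ENNReal.tsum_comm]
  refine tsum_congr fun n => ?_
  rw [ENNReal.tsum_comm]

/-- The potential of `f` is the smallest nonnegative supersolution of `w h = f + a h`. -/
lemma tsum_potential_le (hw0 : ∀ x, w x ≠ 0) (hw : ∀ x, w x ≠ ∞) (f h : S → ℝ≥0∞)
    (hh : ∀ x, f x + ∑' z, a x z * h z ≤ w x * h x) (x : S) :
    ∑' y, potential w a x y * f y ≤ h x := by
  have key : ∀ N x, ∑ n ∈ Finset.range N, ∑' y, potentialTerm w a n x y * f y ≤ h x := by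
    intro N
    induction N with
    | zero => simp
    | succ N ih =>
      intro x
      rw [Finset.sum_range_succ']
      simp only [potentialTerm]
      rw [tsum_ite_eq_mul]
      have h1 : ∀ n, ∑' y, (w x)⁻¹ * (∑' z, a x z * potentialTerm w a n z y) * f y =
          (w x)⁻¹ * ∑' z, a x z * ∑' y, potentialTerm w a n z y * f y := by
        intro n
        simp only [← ENNReal.tsum_mul_left, ← ENNReal.tsum_mul_right]
        rw [ENNReal.tsum_comm]
        simp only [mul_assoc]
      simp only [h1]
      rw [← Finset.mul_sum, ← mul_add, ← ENNReal.inv_mul_cancel_left (hw0 x) (hw x) (b := h x)]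
      gcongr
      refine le_trans ?_ (hh x)
      rw [add_comm, ← Summable.tsum_finsetSum (fun _ _ => ENNReal.summable)]
      simp only [← Finset.mul_sum]
      gcongr
      exact ih _
  simp only [potential, ← ENNReal.tsum_mul_right]
  rw [ENNReal.tsum_comm, ENNReal.tsum_eq_iSup_nat]
  exact iSup_le fun N => key N x

/-- The forward equation `f G w = f + f G a` of the potential kernel `G`. -/
lemma tsum_mul_potential_mul (hw0 : ∀ x, w x ≠ 0) (hw : ∀ x, w x ≠ ∞) (f : S → ℝ≥0∞) (y : S) :
    (∑' x, f x * potential w a x y) * w y =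
      f y + ∑' z, (∑' x, f x * potential w a x z) * a z y := by
  have := mul_tsum_potential (a := fun u v => a v u) hw0 hw f y
  simpa only [potential_transpose, mul_comm] using this

lemma tsum_mul_potential_le (hw0 : ∀ x, w x ≠ 0) (hw : ∀ x, w x ≠ ∞) (f h : S → ℝ≥0∞)
    (hh : ∀ y, f y + ∑' z, h z * a z y ≤ h y * w y) (y : S) :
    ∑' x, f x * potential w a x y ≤ h y := by
  have := tsum_potential_le (a := fun u v => a v u) hw0 hw f h
    (fun x => by simpa only [mul_comm] using hh x) y
  simpa only [potential_transpose, mul_comm] using this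

lemma potential_self_pos (hw : ∀ x, w x ≠ ∞) (x : S) : 0 < potential w a x x := by
  refine lt_of_lt_of_le ?_ (ENNReal.le_tsum 0)
  simp [potentialTerm, hw]

lemma potential_pos (hw0 : ∀ x, w x ≠ 0) (hw : ∀ x, w x ≠ ∞) {x y : S}
    (h : Relation.ReflTransGen (fun u v => 0 < a u v) x y) : 0 < potential w a x y := by
  induction h using Relation.ReflTransGen.head_induction_on with
  | refl => exact potential_self_pos hw y
  | @head u v huv _ ih =>
    have h1 := mul_tsum_potential (a := a) hw0 hw (fun z => if z = y then 1 else 0) u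
    simp only [tsum_mul_ite_eq (c := fun _ => 1), mul_one] at h1
    have h2 : 0 < w u * potential w a u y := by
      rw [h1]
      refine lt_of_lt_of_le ?_ le_add_self
      exact lt_of_lt_of_le (ENNReal.mul_pos huv.ne' ih.ne') (ENNReal.le_tsum v)
    exact pos_of_mul_pos_right h2 (zero_le)

end Potential

/-! ### Positive stochastic kernels and their semigroups -/

section Kernels

variable {S : Type*}

lemma eq_of_le_of_tsum_le {f g : S → ℝ≥0∞} (hf : ∑' x, f x ≠ ∞) (h : ∀ x, f x ≤ g x)
    (hs : ∑' x, g x ≤ ∑' x, f x) : f = g := by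
  by_contra hne
  obtain ⟨i, hi⟩ := Function.ne_iff.1 hne
  exact absurd (ENNReal.tsum_lt_tsum hf h (lt_of_le_of_ne (h i) hi)) hs.not_gt

/-- A bounded superharmonic function of a positive stochastic kernel with a positive stationary
distribution is constant: the function and its truncation at the height of one of its values have
the same mean before and after one step. -/
lemma superharmonic_const {K : S → S → ℝ≥0∞} (hK : ∀ x, ∑' z, K x z = 1)
    (hpos : ∀ x z, 0 < K x z) {π : S → ℝ≥0∞} (hπ : ∑' x, π x = 1) (hπpos : ∀ x, 0 < π x)
    (hinv : ∀ y, ∑' x, π x * K x y = π y) {f : S → ℝ≥0∞} (hf1 : ∀ x, f x ≤ 1)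
    (hf : ∀ x, ∑' z, K x z * f z ≤ f x) (x y : S) : f x = f y := by
  suffices h : ∀ x y, f x ≤ f y from le_antisymm (h x y) (h y x)
  clear x y
  intro x y
  set g : S → ℝ≥0∞ := fun z => min (f z) (f x) with hg
  have hg1 : ∀ z, g z ≤ 1 := fun z => (min_le_left _ _).trans (hf1 z)
  have hfx : f x ≠ ∞ := ((hf1 x).trans_lt ENNReal.one_lt_top).ne
  have hgs : ∀ u, ∑' z, K u z * g z ≤ g u := by
    intro u
    refine le_min ((ENNReal.tsum_le_tsum fun z => ?_).trans (hf u)) ?_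
    · gcongr
      exact min_le_left _ _
    · calc ∑' z, K u z * g z ≤ ∑' z, K u z * f x :=
            ENNReal.tsum_le_tsum fun z => by gcongr; exact min_le_right _ _
        _ = f x := by rw [ENNReal.tsum_mul_right, hK, one_mul]
  have hmean : ∑' u, π u * ∑' z, K u z * g z = ∑' u, π u * g u := by
    simp only [← ENNReal.tsum_mul_left]
    rw [ENNReal.tsum_comm]
    refine tsum_congr fun z => ?_
    simp only [← mul_assoc]
    rw [ENNReal.tsum_mul_right, hinv]
  have hfin : ∑' u, π u * g u ≤ 1 := by
    rw [← hπ]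
    exact ENNReal.tsum_le_tsum fun u => mul_le_of_le_one_right (zero_le) (hg1 u)
  have hπtop : ∀ u, π u ≠ ∞ := fun u =>
    (((ENNReal.le_tsum u).trans hπ.le).trans_lt ENNReal.one_lt_top).ne
  have heq := eq_of_le_of_tsum_le (f := fun u => π u * ∑' z, K u z * g z)
    (g := fun u => π u * g u) (by rw [hmean]; exact (hfin.trans_lt ENNReal.one_lt_top).ne)
    (fun u => by gcongr; exact hgs u) hmean.ge
  have hx : ∑' z, K x z * g z = f x := by
    have h1 := congrFun heq x
    simp only [ENNReal.mul_right_inj (hπpos x).ne' (hπtop x)] at h1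
    rw [h1, hg]
    exact min_self _
  have hKx : ∑' z, K x z * f x = f x := by rw [ENNReal.tsum_mul_right, hK, one_mul]
  have h2 := congrFun (eq_of_le_of_tsum_le (f := fun z => K x z * g z)
    (g := fun z => K x z * f x) (by rw [hx]; exact hfx)
    (fun z => by gcongr; exact min_le_right _ _) (by rw [hKx, hx])) y
  have hKtop : K x y ≠ ∞ :=
    (((ENNReal.le_tsum y).trans (hK x).le).trans_lt ENNReal.one_lt_top).ne
  simp only [ENNReal.mul_right_inj (hpos x y).ne' hKtop] at h2
  rw [← h2]
  exact min_le_left _ _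

/-- A positive stochastic kernel has at most one stationary distribution: the minimum of two of
them is invariant, and so are the two differences; one of these vanishes somewhere, hence
everywhere. -/
lemma invariant_unique {K : S → S → ℝ≥0∞} (hK : ∀ x, ∑' z, K x z = 1)
    (hpos : ∀ x z, 0 < K x z) {π ν : S → ℝ≥0∞} (hπ : ∑' x, π x = 1) (hν : ∑' x, ν x = 1)
    (hπinv : ∀ y, ∑' x, π x * K x y = π y) (hνinv : ∀ y, ∑' x, ν x * K x y = ν y) : ν = π := by
  set η : S → ℝ≥0∞ := fun x => min (π x) (ν x) with hη
  have hηπ : ∀ x, η x ≤ π x := fun x => min_le_left _ _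
  have hην : ∀ x, η x ≤ ν x := fun x => min_le_right _ _
  have hmass : ∑' y, ∑' x, η x * K x y = ∑' x, η x := by
    rw [ENNReal.tsum_comm]
    simp only [ENNReal.tsum_mul_left, hK, mul_one]
  have hle : ∀ y, ∑' x, η x * K x y ≤ η y := fun y => le_min
    ((ENNReal.tsum_le_tsum fun x => by gcongr; exact hηπ x).trans (hπinv y).le)
    ((ENNReal.tsum_le_tsum fun x => by gcongr; exact hην x).trans (hνinv y).le)
  have hηfin : ∑' x, η x ≠ ∞ :=
    (((ENNReal.tsum_le_tsum hηπ).trans hπ.le).trans_lt ENNReal.one_lt_top).ne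
  have hηinv : ∀ y, ∑' x, η x * K x y = η y := fun y =>
    congrFun (eq_of_le_of_tsum_le (by rw [hmass]; exact hηfin) hle hmass.ge) y
  have hηtop : ∀ x, η x ≠ ∞ := fun x => ne_top_of_le_ne_top hηfin (ENNReal.le_tsum x)
  -- if the nonnegative invariant vector `ρ - η` vanishes at a point, it vanishes
  have hdiff : ∀ ρ : S → ℝ≥0∞, (∀ x, η x ≤ ρ x) → (∀ y, ∑' x, ρ x * K x y = ρ y) →
      ∀ y, ρ y = η y → ∀ x, ρ x = η x := by
    intro ρ hρ hρinv y hy x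
    have hsplit : ∀ x, ρ x = η x + (ρ x - η x) := fun x => (add_tsub_cancel_of_le (hρ x)).symm
    have h1 : η y + ∑' x, (ρ x - η x) * K x y = η y + 0 := by
      conv_rhs => rw [add_zero, ← hy, ← hρinv y]
      conv_lhs => rw [← hηinv y]
      rw [← ENNReal.tsum_add]
      refine tsum_congr fun x => ?_
      rw [← add_mul, ← hsplit x]
    have h2 := (ENNReal.add_right_inj (hηtop y)).1 h1
    have h3 := ENNReal.tsum_eq_zero.1 h2 x
    rcases mul_eq_zero.1 h3 with h4 | h4
    · exact le_antisymm (tsub_eq_zero_iff_le.1 h4) (hρ x)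
    · exact absurd h4 (hpos x y).ne'
  have hcomp : ∀ {α β : S → ℝ≥0∞}, ∑' x, α x = 1 → ∑' x, β x = 1 → (∀ x, α x = η x) →
      (∀ x, η x ≤ β x) → α = β := by
    intro α β hα hβ h1 h2
    exact eq_of_le_of_tsum_le (by rw [hα]; exact ENNReal.one_ne_top)
      (fun x => (h1 x).trans_le (h2 x)) (by rw [hα, hβ])
  rcases isEmpty_or_nonempty S with hS | ⟨⟨x₀⟩⟩
  · exact funext fun x => hS.elim x
  rcases le_total (π x₀) (ν x₀) with h | h
  · exact (hcomp hπ hν (hdiff π hηπ hπinv x₀ (min_eq_left h).symm) hην).symm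
  · exact hcomp hν hπ (hdiff ν hην hνinv x₀ (min_eq_right h).symm) hηπ

/-- The mass that the distributions at time `t` from `x` and from `x'` have in common. -/
noncomputable def overlap (P : ℝ → S → S → ℝ≥0∞) (t : ℝ) (x x' : S) : ℝ≥0∞ :=
  ∑' y, min (P t x y) (P t x' y)

variable {P : ℝ → S → S → ℝ≥0∞}

lemma overlap_mono (hP : ∀ t, 0 ≤ t → ∀ x, ∑' y, P t x y = 1)
    (hCK : ∀ s t, 0 ≤ s → 0 ≤ t → ∀ x y, P (s + t) x y = ∑' z, P s x z * P t z y)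
    {s t : ℝ} (hs : 0 ≤ s) (hst : s ≤ t) (x x' : S) : overlap P s x x' ≤ overlap P t x x' := by
  have h0 : 0 ≤ t - s := sub_nonneg.2 hst
  have h1 : ∀ x y, P t x y = ∑' z, P s x z * P (t - s) z y := by
    intro x y
    rw [← hCK s (t - s) hs h0, add_sub_cancel]
  calc overlap P s x x' = ∑' z, min (P s x z) (P s x' z) * ∑' y, P (t - s) z y := by
        simp only [hP _ h0, mul_one, overlap]
    _ = ∑' y, ∑' z, min (P s x z) (P s x' z) * P (t - s) z y := by
        rw [ENNReal.tsum_comm]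
        simp only [ENNReal.tsum_mul_left]
    _ ≤ overlap P t x x' := by
        refine ENNReal.tsum_le_tsum fun y => le_min ?_ ?_
        · rw [h1]
          exact ENNReal.tsum_le_tsum fun z => by gcongr; exact min_le_left _ _
        · rw [h1]
          exact ENNReal.tsum_le_tsum fun z => by gcongr; exact min_le_right _ _

/-- Two independent copies of the chain have a superharmonic overlap, up to a time shift. -/
lemma tsum_mul_overlap_le (hP : ∀ t, 0 ≤ t → ∀ x, ∑' y, P t x y = 1)
    (hCK : ∀ s t, 0 ≤ s → 0 ≤ t → ∀ x y, P (s + t) x y = ∑' z, P s x z * P t z y)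
    {s t : ℝ} (hs : 0 ≤ s) (ht : 0 ≤ t) (x x' : S) :
    ∑' z : S × S, (P s x z.1 * P s x' z.2) * overlap P t z.1 z.2 ≤ overlap P (s + t) x x' := by
  have h1 : ∀ y, ∑' z : S × S, (P s x z.1 * P s x' z.2) * P t z.1 y = P (s + t) x y := by
    intro y
    rw [ENNReal.tsum_prod (f := fun a b => (P s x a * P s x' b) * P t a y), hCK s t hs ht]
    refine tsum_congr fun a => ?_
    rw [ENNReal.tsum_mul_right, ENNReal.tsum_mul_left, hP s hs, mul_one]
  have h2 : ∀ y, ∑' z : S × S, (P s x z.1 * P s x' z.2) * P t z.2 y = P (s + t) x' y := by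
    intro y
    rw [ENNReal.tsum_prod (f := fun a b => (P s x a * P s x' b) * P t b y), ENNReal.tsum_comm,
      hCK s t hs ht]
    refine tsum_congr fun b => ?_
    simp only [mul_assoc]
    rw [ENNReal.tsum_mul_right, hP s hs, one_mul]
  simp only [overlap, ← ENNReal.tsum_mul_left]
  rw [ENNReal.tsum_comm]
  refine ENNReal.tsum_le_tsum fun y => le_min ?_ ?_
  · rw [← h1 y]
    exact ENNReal.tsum_le_tsum fun z => by gcongr; exact min_le_left _ _
  · rw [← h2 y]
    exact ENNReal.tsum_le_tsum fun z => by gcongr; exact min_le_right _ _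

lemma overlap_le_one (hP : ∀ t, 0 ≤ t → ∀ x, ∑' y, P t x y = 1) {t : ℝ} (ht : 0 ≤ t)
    (x x' : S) : overlap P t x x' ≤ 1 := by
  rw [← hP t ht x]
  exact ENNReal.tsum_le_tsum fun y => min_le_left _ _

lemma add_overlap_le (hP : ∀ t, 0 ≤ t → ∀ x, ∑' y, P t x y = 1) {t : ℝ} (ht : 0 ≤ t)
    (x x' y : S) : P t x y + overlap P t x x' ≤ 1 + P t x' y := by
  classical
  rw [← hP t ht x, overlap, ENNReal.tsum_eq_add_tsum_ite (f := fun y => P t x y) y,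
    ENNReal.tsum_eq_add_tsum_ite (f := fun y => min (P t x y) (P t x' y)) y]
  have h1 : ∑' z, (if z = y then 0 else min (P t x z) (P t x' z)) ≤
      ∑' z, (if z = y then 0 else P t x z) := ENNReal.tsum_le_tsum fun z => by
    split_ifs
    · exact le_rfl
    · exact min_le_left _ _
  calc P t x y + (min (P t x y) (P t x' y) + ∑' z, (if z = y then 0 else min (P t x z) (P t x' z)))
      ≤ P t x y + (P t x' y + ∑' z, (if z = y then 0 else P t x z)) := by
        gcongr
        exact min_le_right _ _
    _ = _ := by ring

/-- With the passage of time any two initial states are forgotten completely. -/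
lemma iSup_overlap_eq_one (hP : ∀ t, 0 ≤ t → ∀ x, ∑' y, P t x y = 1)
    (hCK : ∀ s t, 0 ≤ s → 0 ≤ t → ∀ x y, P (s + t) x y = ∑' z, P s x z * P t z y)
    (hpos : ∀ x y, 0 < P 1 x y) {π : S → ℝ≥0∞} (hπ : ∑' x, π x = 1) (hπpos : ∀ x, 0 < π x)
    (hinv : ∀ y, ∑' x, π x * P 1 x y = π y) (x x' : S) :
    ⨆ n : ℕ, overlap P n x x' = 1 := by
  have hmono : ∀ z : S × S, Monotone fun n : ℕ => overlap P n z.1 z.2 := fun z m n hmn =>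
    overlap_mono hP hCK (Nat.cast_nonneg m) (Nat.cast_le.2 hmn) _ _
  have hconst := superharmonic_const (S := S × S) (K := fun z u => P 1 z.1 u.1 * P 1 z.2 u.2)
    (π := fun z => π z.1 * π z.2) (f := fun z => ⨆ n : ℕ, overlap P n z.1 z.2)
    (fun z => by
      rw [ENNReal.tsum_prod (f := fun a b => P 1 z.1 a * P 1 z.2 b)]
      simp only [ENNReal.tsum_mul_left, hP 1 zero_le_one, mul_one])
    (fun z u => ENNReal.mul_pos (hpos _ _).ne' (hpos _ _).ne')
    (by
      rw [ENNReal.tsum_prod (f := fun a b => π a * π b)]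
      simp only [ENNReal.tsum_mul_left, hπ, mul_one])
    (fun z => ENNReal.mul_pos (hπpos _).ne' (hπpos _).ne')
    (fun u => by
      rw [ENNReal.tsum_prod (f := fun a b => π a * π b * (P 1 a u.1 * P 1 b u.2))]
      simp only [fun a b => mul_mul_mul_comm (π a) (π b) (P 1 a u.1) (P 1 b u.2),
        ENNReal.tsum_mul_left, ENNReal.tsum_mul_right, hinv])
    (fun z => iSup_le fun n => overlap_le_one hP (Nat.cast_nonneg n) _ _)
    (fun z => by
      simp only [ENNReal.mul_iSup]
      rw [ENNReal.tsum_eq_iSup_sum]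
      refine iSup_le fun F => ?_
      rw [ENNReal.finsetSum_iSup_of_monotone fun u m n hmn => by gcongr; exact hmono u hmn]
      refine iSup_le fun n => ?_
      refine ((ENNReal.sum_le_tsum F).trans
        (tsum_mul_overlap_le hP hCK zero_le_one (Nat.cast_nonneg n) z.1 z.2)).trans ?_
      rw [add_comm, ← Nat.cast_add_one]
      exact le_iSup (fun n : ℕ => overlap P n z.1 z.2) (n + 1))
    (x, x') (x, x)
  simp only at hconst
  rw [hconst]
  simp [overlap, hP]

/-- A semigroup of stochastic kernels with positive entries and a positive stationary distribution
converges to it. -/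
theorem tendsto_stationary (hP : ∀ t, 0 ≤ t → ∀ x, ∑' y, P t x y = 1)
    (hCK : ∀ s t, 0 ≤ s → 0 ≤ t → ∀ x y, P (s + t) x y = ∑' z, P s x z * P t z y)
    (hpos : ∀ x y, 0 < P 1 x y) {π : S → ℝ≥0∞} (hπpos : ∀ x, 0 < π x)
    (hπ : IsStationaryDistribution P π) (x y : S) :
    Tendsto (fun t => P t x y) atTop (𝓝 (π y)) := by
  -- the mean overlap, for the second initial state distributed according to `π`
  set M : ℝ → ℝ≥0∞ := fun t => ∑' x', π x' * overlap P t x x' with hM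
  have hM1 : ∀ t, 0 ≤ t → M t ≤ 1 := fun t ht => by
    rw [← hπ.1]
    exact ENNReal.tsum_le_tsum fun u => mul_le_of_le_one_right (zero_le) (overlap_le_one hP ht _ _)
  have hMmono : ∀ s t, 0 ≤ s → s ≤ t → M s ≤ M t := fun s t hs hst =>
    ENNReal.tsum_le_tsum fun u => by gcongr; exact overlap_mono hP hCK hs hst _ _
  have hMsup : ⨆ n : ℕ, M n = 1 := by
    refine le_antisymm (iSup_le fun n => hM1 n (Nat.cast_nonneg n)) ?_
    calc (1 : ℝ≥0∞) = ∑' u, π u * ⨆ n : ℕ, overlap P n x u := by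
          simp only [iSup_overlap_eq_one hP hCK hpos hπ.1 hπpos (hπ.2 1 zero_le_one), mul_one, hπ.1]
      _ ≤ ⨆ n : ℕ, M n := by
          simp only [ENNReal.mul_iSup]
          rw [ENNReal.tsum_eq_iSup_sum]
          refine iSup_le fun F => ?_
          rw [ENNReal.finsetSum_iSup_of_monotone fun u m n hmn => by
            gcongr
            exact overlap_mono hP hCK (Nat.cast_nonneg m) (Nat.cast_le.2 hmn) _ _]
          exact iSup_mono fun n => ENNReal.sum_le_tsum F
  have hMlim : Tendsto M atTop (𝓝 1) := by
    refine tendsto_order.2 ⟨fun b hb => ?_, fun b hb => ?_⟩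
    · rw [← hMsup] at hb
      obtain ⟨n, hn⟩ := lt_iSup_iff.1 hb
      filter_upwards [eventually_ge_atTop (n : ℝ)] with t ht
      exact hn.trans_le (hMmono _ _ (Nat.cast_nonneg n) ht)
    · filter_upwards [eventually_ge_atTop (0 : ℝ)] with t ht
      exact (hM1 t ht).trans_lt hb
  have hup : ∀ t, 0 ≤ t → P t x y + M t ≤ 1 + π y := by
    intro t ht
    calc P t x y + M t = ∑' u, π u * (P t x y + overlap P t x u) := by
          simp only [mul_add]
          rw [ENNReal.tsum_add, ENNReal.tsum_mul_right, hπ.1, one_mul]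
      _ ≤ ∑' u, π u * (1 + P t u y) :=
          ENNReal.tsum_le_tsum fun u => mul_le_mul' le_rfl (add_overlap_le hP ht _ _ _)
      _ = 1 + π y := by
          simp only [mul_add, mul_one]
          rw [ENNReal.tsum_add, hπ.1, hπ.2 t ht]
  have hlow : ∀ t, 0 ≤ t → π y + M t ≤ 1 + P t x y := by
    intro t ht
    calc π y + M t = ∑' u, π u * (P t u y + overlap P t u x) := by
          simp only [mul_add]
          rw [ENNReal.tsum_add, hπ.2 t ht]
          simp only [hM, overlap, min_comm]
      _ ≤ ∑' u, π u * (1 + P t x y) :=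
          ENNReal.tsum_le_tsum fun u => mul_le_mul' le_rfl (add_overlap_le hP ht _ _ _)
      _ = 1 + P t x y := by rw [ENNReal.tsum_mul_right, hπ.1, one_mul]
  have hgap : Tendsto (fun t => 1 - M t) atTop (𝓝 0) := by
    have := ENNReal.Tendsto.sub (tendsto_const_nhds (x := (1 : ℝ≥0∞))) hMlim
      (Or.inl ENNReal.one_ne_top)
    simpa using this
  have hsplit : ∀ t, 0 ≤ t → M t + (1 - M t) = 1 := fun t ht => add_tsub_cancel_of_le (hM1 t ht)
  have hMtop : ∀ t, 0 ≤ t → M t ≠ ∞ := fun t ht => ne_top_of_le_ne_top ENNReal.one_ne_top (hM1 t ht)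
  have hπy : π y ≠ ∞ :=
    ne_top_of_le_ne_top ENNReal.one_ne_top ((ENNReal.le_tsum y).trans hπ.1.le)
  refine tendsto_of_tendsto_of_tendsto_of_le_of_le' (g := fun t => π y - (1 - M t))
    (h := fun t => π y + (1 - M t)) ?_ ?_ ?_ ?_
  · simpa using ENNReal.Tendsto.sub (tendsto_const_nhds (x := π y)) hgap (Or.inl hπy)
  · simpa using (tendsto_const_nhds (x := π y)).add hgap
  · filter_upwards [eventually_ge_atTop (0 : ℝ)] with t ht
    refine tsub_le_iff_right.2 ((ENNReal.add_le_add_iff_right (hMtop t ht)).1 ?_)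
    refine (hlow t ht).trans_eq ?_
    rw [add_assoc, add_comm (1 - M t), hsplit t ht, add_comm]
  · filter_upwards [eventually_ge_atTop (0 : ℝ)] with t ht
    refine (ENNReal.add_le_add_iff_right (hMtop t ht)).1 ?_
    refine (hup t ht).trans_eq ?_
    rw [add_assoc, add_comm (1 - M t), hsplit t ht, add_comm]

end Kernels

/-! ### Conservative generators and transition functions -/

section Chains

variable {S : Type*} [DecidableEq S]

/-- The rate of the jumps from `x` to `z ≠ x`, as an extended nonnegative number. -/
noncomputable def jumpRate (q : S → S → ℝ) (x z : S) : ℝ≥0∞ :=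
  if z = x then 0 else ENNReal.ofReal (q x z)

/-- The total rate at which `x` is left. -/
noncomputable def exitRate (q : S → S → ℝ) (x : S) : ℝ≥0∞ :=
  ENNReal.ofReal (-q x x)

/-- `q` is a stable and conservative generator. -/
structure IsConservativeGenerator (q : S → S → ℝ) : Prop where
  diag_nonpos : ∀ x, q x x ≤ 0
  offDiag_nonneg : ∀ x y, x ≠ y → 0 ≤ q x y
  tsum_jumpRate : ∀ x, ∑' z, jumpRate q x z = exitRate q x

variable (q : S → S → ℝ)

lemma ctmcJumpProb_succ (n : ℕ) (t : ℝ) (x y : S) :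
    ctmcJumpProb q (n + 1) t x y = ∫⁻ s in Set.Icc 0 t, ENNReal.ofReal (Real.exp (q x x * s)) *
      ∑' z, jumpRate q x z * ctmcJumpProb q n (t - s) z y := rfl

lemma measurable_exp_ofReal (c : ℝ) :
    Measurable fun s : ℝ => ENNReal.ofReal (Real.exp (c * s)) := by fun_prop

lemma measurable_setLIntegral_Icc_conv {E G : ℝ → ℝ≥0∞} (hE : Measurable E)
    (hG : Measurable G) : Measurable fun t : ℝ => ∫⁻ s in Set.Icc 0 t, E s * G (t - s) := by
  have h1 : ∀ t : ℝ, ∫⁻ s in Set.Icc 0 t, E s * G (t - s) =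
      ∫⁻ s, Set.indicator {p : ℝ × ℝ | 0 ≤ p.2 ∧ p.2 ≤ p.1}
        (fun p => E p.2 * G (p.1 - p.2)) (t, s) := by
    intro t
    rw [← lintegral_indicator measurableSet_Icc]
    rfl
  simp only [h1]
  refine Measurable.lintegral_prod_right' (Measurable.indicator (by fun_prop) ?_)
  exact (measurableSet_le measurable_const measurable_snd).inter
    (measurableSet_le measurable_snd measurable_fst)

variable [Countable S]

lemma measurable_ctmcJumpProb (n : ℕ) (x y : S) :
    Measurable fun t => ctmcJumpProb q n t x y := by
  induction n generalizing x with
  | zero =>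
    simp only [ctmcJumpProb]
    split_ifs
    · exact measurable_exp_ofReal _
    · exact measurable_const
  | succ n ih =>
    simp only [ctmcJumpProb_succ]
    exact measurable_setLIntegral_Icc_conv (measurable_exp_ofReal _)
      (Measurable.tsum fun z => (ih z).const_mul _)

lemma measurable_ctmcTransition (x y : S) : Measurable fun t => ctmcTransition q t x y :=
  Measurable.tsum fun n => measurable_ctmcJumpProb q n x y

/-! ### The Laplace transform of the transition function -/

/-- The Laplace transform at `1` turns convolutions into products. -/
lemma lintegral_exp_mul_conv {E G : ℝ → ℝ≥0∞} (hE : Measurable E) (hG : Measurable G) :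
    ∫⁻ t in Set.Ici 0, ENNReal.ofReal (Real.exp (-t)) * ∫⁻ s in Set.Icc 0 t, E s * G (t - s) =
      (∫⁻ s in Set.Ici 0, ENNReal.ofReal (Real.exp (-s)) * E s) *
        ∫⁻ u in Set.Ici 0, ENNReal.ofReal (Real.exp (-u)) * G u := by
  set e : ℝ → ℝ≥0∞ := fun t => ENNReal.ofReal (Real.exp (-t)) with he
  have hem : Measurable e := by fun_prop
  set E' : ℝ → ℝ≥0∞ := Set.indicator (Set.Ici 0) (fun s => e s * E s) with hE'
  set G' : ℝ → ℝ≥0∞ := Set.indicator (Set.Ici 0) (fun s => e s * G s) with hG'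
  have hE'm : Measurable E' := (hem.mul hE).indicator measurableSet_Ici
  have hG'm : Measurable G' := (hem.mul hG).indicator measurableSet_Ici
  have h1 : ∫⁻ t in Set.Ici 0, e t * ∫⁻ s in Set.Icc 0 t, E s * G (t - s) =
      ∫⁻ t, ∫⁻ s, E' s * G' (t - s) := by
    rw [← lintegral_indicator measurableSet_Ici]
    refine lintegral_congr fun t => ?_
    by_cases ht : 0 ≤ t
    · rw [Set.indicator_of_mem (Set.mem_Ici.2 ht), ← lintegral_const_mul _ (by fun_prop),
        ← lintegral_indicator measurableSet_Icc]
      refine lintegral_congr fun s => ?_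
      by_cases hs : 0 ≤ s <;> by_cases hst : s ≤ t <;>
        simp only [Set.indicator, Set.mem_Icc, Set.mem_Ici, hs, hst, sub_nonneg, hE', hG',
          and_self, and_true, and_false, if_true, if_false, zero_mul, mul_zero]
      have : e t = e s * e (t - s) := by
        simp only [he]
        rw [← ENNReal.ofReal_mul (Real.exp_nonneg _), ← Real.exp_add]
        congr 2
        ring
      rw [this]
      ring
    · rw [Set.indicator_of_notMem (by simpa using ht)]
      symm
      refine (lintegral_congr fun s => ?_).trans lintegral_zero
      by_cases hs : 0 ≤ s
      · have : ¬ (0 ≤ t - s) := by linarith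
        simp [hG', this]
      · simp [hE', hs]
  rw [h1, lintegral_lintegral_swap (by fun_prop)]
  have h2 : ∀ s, ∫⁻ t, E' s * G' (t - s) = E' s * ∫⁻ t, G' t := by
    intro s
    rw [lintegral_const_mul _ (by fun_prop), lintegral_sub_right_eq_self G' s]
  simp only [h2]
  rw [lintegral_mul_const _ hE'm, ← lintegral_indicator measurableSet_Ici,
    ← lintegral_indicator measurableSet_Ici]

lemma lintegral_exp_neg {c : ℝ} (hc : 0 < c) :
    ∫⁻ t in Set.Ici (0 : ℝ), ENNReal.ofReal (Real.exp (-c * t)) = (ENNReal.ofReal c)⁻¹ := by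
  rw [setLIntegral_congr Ioi_ae_eq_Ici.symm,
    ← ofReal_integral_eq_lintegral_ofReal (exp_neg_integrableOn_Ioi 0 hc)
      (Eventually.of_forall fun t => Real.exp_nonneg _), ← ENNReal.ofReal_inv_of_pos hc]
  congr 1
  have := integral_exp_mul_Ioi (a := -c) (by linarith) 0
  rw [this]
  simp

/-- The Laplace transform at `1` of the probabilities to be at `y` after `n` jumps. -/
lemma lintegral_exp_mul_ctmcJumpProb (hq : ∀ x, q x x ≤ 0) (n : ℕ) (x y : S) :
    ∫⁻ t in Set.Ici 0, ENNReal.ofReal (Real.exp (-t)) * ctmcJumpProb q n t x y =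
      potentialTerm (fun x => 1 + exitRate q x) (jumpRate q) n x y := by
  have h0 : ∀ x, ∫⁻ t in Set.Ici (0 : ℝ), ENNReal.ofReal (Real.exp (-t)) *
      ENNReal.ofReal (Real.exp (q x x * t)) = (1 + exitRate q x)⁻¹ := by
    intro x
    rw [exitRate, ← ENNReal.ofReal_one, ← ENNReal.ofReal_add zero_le_one (by linarith [hq x]),
      ← lintegral_exp_neg (by linarith [hq x])]
    refine lintegral_congr fun t => ?_
    rw [← ENNReal.ofReal_mul (Real.exp_nonneg _), ← Real.exp_add]
    congr 2
    ring
  induction n generalizing x with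
  | zero =>
    simp only [ctmcJumpProb, potentialTerm]
    split_ifs
    · exact h0 x
    · simp
  | succ n ih =>
    have hm : ∀ z, Measurable fun t => jumpRate q x z * ctmcJumpProb q n t z y :=
      fun z => (measurable_ctmcJumpProb q n z y).const_mul _
    simp only [ctmcJumpProb_succ, potentialTerm]
    rw [lintegral_exp_mul_conv (measurable_exp_ofReal _)
      (G := fun u => ∑' z, jumpRate q x z * ctmcJumpProb q n u z y)
      (Measurable.tsum hm), h0]
    congr 1
    simp only [← ENNReal.tsum_mul_left]
    have he : Measurable fun t : ℝ => ENNReal.ofReal (Real.exp (-t)) := by fun_prop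
    rw [lintegral_tsum fun z => by exact (he.mul (hm z)).aemeasurable]
    refine tsum_congr fun z => ?_
    rw [← ih, ← lintegral_const_mul _ (by exact he.mul (measurable_ctmcJumpProb q n z y))]
    refine lintegral_congr fun t => ?_
    ring

/-- The kernel `(r - q)⁻¹`, the resolvent of the minimal chain with generator `q`. -/
noncomputable def resolventKernel (r : ℝ≥0∞) : S → S → ℝ≥0∞ :=
  potential (fun x => r + exitRate q x) (jumpRate q)

lemma lintegral_exp_mul_ctmcTransition (hq : ∀ x, q x x ≤ 0) (x y : S) :
    ∫⁻ t in Set.Ici 0, ENNReal.ofReal (Real.exp (-t)) * ctmcTransition q t x y =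
      resolventKernel q 1 x y := by
  simp only [ctmcTransition, resolventKernel, potential, ← ENNReal.tsum_mul_left,
    ← lintegral_exp_mul_ctmcJumpProb q hq]
  exact lintegral_tsum fun n => ((by fun_prop : Measurable fun t : ℝ =>
    ENNReal.ofReal (Real.exp (-t))).mul (measurable_ctmcJumpProb q n x y)).aemeasurable

/-! ### The semigroup property -/

lemma setLIntegral_Icc_add_conv {E G : ℝ → ℝ≥0∞} {s t : ℝ} (hs : 0 ≤ s) (ht : 0 ≤ t) :
    ∫⁻ u in Set.Icc 0 (s + t), E u * G (s + t - u) =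
      (∫⁻ u in Set.Icc 0 s, E u * G (s - u + t)) + ∫⁻ u in Set.Icc 0 t, E (s + u) * G (t - u) := by
  have h1 : Set.Icc 0 (s + t) = Set.Icc 0 s ∪ Set.Ioc s (s + t) :=
    (Set.Icc_union_Ioc_eq_Icc hs (by linarith)).symm
  rw [h1, lintegral_union measurableSet_Ioc (Set.disjoint_left.2 fun u hu hu' =>
    absurd hu.2 (not_le.2 hu'.1))]
  congr 1
  · refine lintegral_congr fun u => ?_
    rw [sub_add_eq_add_sub]
  · rw [setLIntegral_congr Ioc_ae_eq_Icc, ← lintegral_indicator measurableSet_Icc,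
      ← lintegral_indicator measurableSet_Icc, ← lintegral_add_left_eq_self _ s]
    refine lintegral_congr fun u => ?_
    have h2 : s + u ∈ Set.Icc s (s + t) ↔ u ∈ Set.Icc 0 t := by simp
    by_cases hu : u ∈ Set.Icc 0 t
    · rw [Set.indicator_of_mem hu, Set.indicator_of_mem (h2.2 hu)]
      congr 2
      ring
    · rw [Set.indicator_of_notMem hu, Set.indicator_of_notMem (mt h2.1 hu)]

/-- The Chapman-Kolmogorov equation with a prescribed number of jumps. -/
lemma ctmcJumpProb_add (n : ℕ) {s t : ℝ} (hs : 0 ≤ s) (ht : 0 ≤ t) (x y : S) :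
    ctmcJumpProb q n (s + t) x y = ∑ p ∈ Finset.HasAntidiagonal.antidiagonal n,
      ∑' z, ctmcJumpProb q p.1 s x z * ctmcJumpProb q p.2 t z y := by
  have hexp : ∀ (x : S) (u v : ℝ), ENNReal.ofReal (Real.exp (q x x * (u + v))) =
      ENNReal.ofReal (Real.exp (q x x * u)) * ENNReal.ofReal (Real.exp (q x x * v)) := by
    intro x u v
    rw [← ENNReal.ofReal_mul (Real.exp_nonneg _), ← Real.exp_add, mul_add]
  have h0 : ∀ m (x : S), ∑' z, ctmcJumpProb q 0 s x z * ctmcJumpProb q m t z y =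
      ENNReal.ofReal (Real.exp (q x x * s)) * ctmcJumpProb q m t x y := by
    intro m x
    simp only [ctmcJumpProb]
    rw [tsum_ite_eq_mul]
  induction n generalizing x s with
  | zero =>
    simp only [Finset.HasAntidiagonal.antidiagonal_zero, Finset.sum_singleton]
    rw [h0]
    simp only [ctmcJumpProb]
    split_ifs
    · exact hexp x s t
    · simp
  | succ n ih =>
    rw [Finset.Nat.sum_antidiagonal_succ]
    simp only
    rw [h0, ctmcJumpProb_succ, setLIntegral_Icc_add_conv (E := fun u =>
      ENNReal.ofReal (Real.exp (q x x * u))) (G := fun u =>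
      ∑' z, jumpRate q x z * ctmcJumpProb q n u z y) hs ht, add_comm]
    have hmE := measurable_exp_ofReal (q x x)
    congr 1
    · simp only [hexp, mul_assoc]
      rw [lintegral_const_mul]
      · rfl
      · exact hmE.mul (Measurable.tsum fun z =>
          ((measurable_ctmcJumpProb q n z y).comp (measurable_const.sub measurable_id)).const_mul _)
    · have h1 : ∀ u ∈ Set.Icc 0 s, ENNReal.ofReal (Real.exp (q x x * u)) *
          ∑' z, jumpRate q x z * ctmcJumpProb q n (s - u + t) z y =
          ∑ p ∈ Finset.HasAntidiagonal.antidiagonal n, ∑' z, (ENNReal.ofReal (Real.exp (q x x * u)) *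
            ∑' v, jumpRate q x v * ctmcJumpProb q p.1 (s - u) v z) *
              ctmcJumpProb q p.2 t z y := by
        intro u hu
        have hih : ∀ v, ctmcJumpProb q n (s - u + t) v y = ∑ p ∈ Finset.HasAntidiagonal.antidiagonal n,
            ∑' z, ctmcJumpProb q p.1 (s - u) v z * ctmcJumpProb q p.2 t z y := fun v =>
          ih (sub_nonneg.2 hu.2) v (fun m x => by
            simp only [ctmcJumpProb]
            rw [tsum_ite_eq_mul])
        simp only [hih, Finset.mul_sum]
        rw [Summable.tsum_finsetSum (fun _ _ => ENNReal.summable), Finset.mul_sum]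
        refine Finset.sum_congr rfl fun p _ => ?_
        simp only [← ENNReal.tsum_mul_left, ← ENNReal.tsum_mul_right]
        rw [ENNReal.tsum_comm]
        simp only [mul_assoc]
      have hms : ∀ (p : ℕ × ℕ) (z : S), Measurable fun u => (ENNReal.ofReal
          (Real.exp (q x x * u)) * ∑' v, jumpRate q x v * ctmcJumpProb q p.1 (s - u) v z) :=
        fun p z => hmE.mul (Measurable.tsum fun v =>
          ((measurable_ctmcJumpProb q p.1 v z).comp
            (measurable_const.sub measurable_id)).const_mul _)
      rw [setLIntegral_congr_fun measurableSet_Icc h1, lintegral_finsetSum _ fun p _ =>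
        Measurable.tsum fun z => (hms p z).mul_const _]
      refine Finset.sum_congr rfl fun p _ => ?_
      rw [lintegral_tsum fun z => ((hms p z).mul_const _).aemeasurable]
      refine tsum_congr fun z => ?_
      rw [lintegral_mul_const _ (hms p z), ctmcJumpProb_succ]

/-- The Chapman-Kolmogorov equation. -/
lemma ctmcTransition_add {s t : ℝ} (hs : 0 ≤ s) (ht : 0 ≤ t) (x y : S) :
    ctmcTransition q (s + t) x y = ∑' z, ctmcTransition q s x z * ctmcTransition q t z y := by
  have h1 : ∀ z, ctmcTransition q s x z * ctmcTransition q t z y =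
      ∑' n, ∑ p ∈ Finset.HasAntidiagonal.antidiagonal n, ctmcJumpProb q p.1 s x z * ctmcJumpProb q p.2 t z y := by
    intro z
    simp only [ctmcTransition, ← ENNReal.tsum_mul_left, ← ENNReal.tsum_mul_right]
    rw [ENNReal.tsum_comm, ← ENNReal.tsum_prod
      (f := fun a b => ctmcJumpProb q a s x z * ctmcJumpProb q b t z y),
      ← Finset.HasAntidiagonal.sigmaAntidiagonalEquivProd.tsum_eq, ENNReal.tsum_sigma']
    refine tsum_congr fun n => ?_
    rw [tsum_fintype, Finset.univ_eq_attach, ← Finset.sum_attach (Finset.HasAntidiagonal.antidiagonal n)]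
    rfl
  simp only [h1]
  rw [ENNReal.tsum_comm]
  refine tsum_congr fun n => ?_
  rw [ctmcJumpProb_add q n hs ht, Summable.tsum_finsetSum (fun _ _ => ENNReal.summable)]

end Chains

section Chains

lemma add_exitRate_ne_zero {α : Type*} {q : α → α → ℝ} {r : ℝ≥0∞} (hr : r ≠ 0) (x : α) : r + exitRate q x ≠ 0 := by
  simp [hr]

lemma add_exitRate_ne_top {α : Type*} {q : α → α → ℝ} {r : ℝ≥0∞} (hr : r ≠ ∞) (x : α) : r + exitRate q x ≠ ∞ := by
  simp [hr, exitRate]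

lemma ne_top_of_tsum_eq_one {α : Type*} {π : α → ℝ≥0∞} (hπ : ∑' x, π x = 1) (x : α) : π x ≠ ∞ :=
  ne_top_of_le_ne_top ENNReal.one_ne_top ((ENNReal.le_tsum x).trans hπ.le)

variable {S : Type*} [DecidableEq S] {q : S → S → ℝ}

/-! ### Stationary distributions and the balance equations -/

/-- The global balance equations: the probability flows into and out of each state agree. -/
def IsBalanced (q : S → S → ℝ) (π : S → ℝ≥0∞) : Prop :=
  ∀ y, ∑' x, π x * jumpRate q x y = π y * exitRate q y

lemma IsBalanced.of_resolventKernel {π : S → ℝ≥0∞} (hπ1 : ∑' x, π x = 1)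
    (hπ : ∀ y, ∑' x, π x * resolventKernel q 1 x y = π y) : IsBalanced q π := by
  intro y
  have h1 := tsum_mul_potential_mul (a := jumpRate q)
    (add_exitRate_ne_zero (q := q) one_ne_zero) (add_exitRate_ne_top ENNReal.one_ne_top) π y
  change (∑' x, π x * resolventKernel q 1 x y) * _ =
    π y + ∑' z, (∑' x, π x * resolventKernel q 1 x z) * jumpRate q z y at h1
  simp only [hπ] at h1
  rw [mul_add, mul_one, ENNReal.add_right_inj (ne_top_of_tsum_eq_one hπ1 y)] at h1
  exact h1.symm

lemma IsBalanced.pos {π : S → ℝ≥0∞} (hπ1 : ∑' x, π x = 1) (hπ : IsBalanced q π)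
    (hirr : ∀ x y, Relation.ReflTransGen (fun u v => 0 < jumpRate q u v) x y) (y : S) :
    0 < π y := by
  by_contra hy
  have hy0 : π y = 0 := by simpa using hy
  have hall : ∀ x, π x = 0 := by
    intro x
    induction hirr x y using Relation.ReflTransGen.head_induction_on with
    | refl => exact hy0
    | @head u v huv _ ih =>
      have h1 := hπ v
      rw [ih, zero_mul, ENNReal.tsum_eq_zero] at h1
      exact (mul_eq_zero.1 (h1 u)).resolve_right huv.ne'
  simp [hall] at hπ1

/-- If the resolvent is stochastic, then the balance equations imply its invariance: in general
they imply `π R ≤ π`, and both sides have the same mass. -/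
lemma IsBalanced.tsum_mul_resolventKernel {π : S → ℝ≥0∞} (hπ1 : ∑' x, π x = 1)
    (hπ : IsBalanced q π) (hR : ∀ x, ∑' y, resolventKernel q 1 x y = 1) (y : S) :
    ∑' x, π x * resolventKernel q 1 x y = π y := by
  have hle : ∀ y, ∑' x, π x * resolventKernel q 1 x y ≤ π y :=
    tsum_mul_potential_le (add_exitRate_ne_zero one_ne_zero)
      (add_exitRate_ne_top ENNReal.one_ne_top) π π (fun y => by rw [hπ y, mul_add, mul_one])
  have hmass : ∑' y, ∑' x, π x * resolventKernel q 1 x y = 1 := by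
    rw [ENNReal.tsum_comm]
    simp only [ENNReal.tsum_mul_left, hR, mul_one, hπ1]
  exact congrFun (eq_of_le_of_tsum_le (by rw [hmass]; exact ENNReal.one_ne_top) hle
    (by rw [hmass, hπ1])) y

/-! ### Drift conditions -/

/-- The minimum principle for the operator `r - q`. -/
lemma one_le_of_supersolution {r : ℝ≥0∞} (hr0 : r ≠ 0) (hr : r ≠ ∞)
    (hq : IsConservativeGenerator q) {T : S → ℝ≥0∞}
    (hT : ∀ x, r + ∑' z, jumpRate q x z * T z ≤ (r + exitRate q x) * T x)
    (hfin : {x | T x < 1}.Finite) (x : S) : 1 ≤ T x := by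
  by_contra hx
  obtain ⟨m, hm, hmin⟩ := Set.exists_min_image _ T hfin ⟨x, not_le.1 hx⟩
  have hmin' : ∀ z, T m ≤ T z := fun z => by
    by_cases hz : T z < 1
    · exact hmin z hz
    · exact (le_of_lt hm).trans (not_lt.1 hz)
  have hTm : T m ≠ ∞ := (lt_trans hm ENNReal.one_lt_top).ne
  have h1 : r + exitRate q m * T m ≤ r * T m + exitRate q m * T m := by
    rw [← add_mul]
    refine le_trans ?_ (hT m)
    rw [← hq.tsum_jumpRate m, ← ENNReal.tsum_mul_right]
    gcongr with z
    exact hmin' z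
  have hE : exitRate q m * T m ≠ ∞ := ENNReal.mul_ne_top ENNReal.ofReal_ne_top hTm
  have h2 : r * 1 ≤ r * T m := by
    rw [mul_one]
    exact (ENNReal.add_le_add_iff_right hE).1 h1
  exact absurd ((ENNReal.mul_le_mul_iff_right hr0 hr).1 h2) (not_le.2 hm)

/-- The criterion for the absence of explosions: there is a function with finite sublevel sets
whose drift is bounded by a multiple of the function itself. -/
lemma tsum_resolventKernel_mul {r : ℝ≥0∞} (hr0 : r ≠ 0) (hr : r ≠ ∞)
    (hq : IsConservativeGenerator q) {W : S → ℝ≥0∞} (hWtop : ∀ x, W x ≠ ∞)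
    (hW : ∀ x, ∑' z, jumpRate q x z * W z ≤ (r + exitRate q x) * W x)
    (hfin : ∀ c : ℝ≥0∞, c ≠ ∞ → {x | W x < c}.Finite) (x : S) :
    ∑' y, resolventKernel q r x y * r = 1 := by
  have hw0 : ∀ x, r + exitRate q x ≠ 0 := add_exitRate_ne_zero hr0
  have hw : ∀ x, r + exitRate q x ≠ ∞ := add_exitRate_ne_top hr
  refine le_antisymm ?_ ?_
  · refine tsum_potential_le hw0 hw (fun _ => r) (fun _ => 1) (fun x => ?_) x
    simp only [mul_one]
    rw [hq.tsum_jumpRate]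
  · have key : ∀ ε : ℝ≥0∞, ε ≠ 0 → ε ≠ ∞ →
        1 ≤ ∑' y, resolventKernel q r x y * r + ε * W x := by
      intro ε hε0 hε
      refine one_le_of_supersolution hr0 hr hq
        (T := fun x => ∑' y, resolventKernel q r x y * r + ε * W x) (fun x => ?_) ?_ x
      · rw [mul_add]
        have h1 := mul_tsum_potential (a := jumpRate q) hw0 hw (fun _ => r) x
        change _ * ∑' y, resolventKernel q r x y * r =
          r + ∑' z, jumpRate q x z * ∑' y, resolventKernel q r z y * r at h1
        rw [h1, add_assoc]
        simp only [mul_add]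
        rw [ENNReal.tsum_add]
        gcongr
        simp only [mul_left_comm _ ε]
        rw [ENNReal.tsum_mul_left]
        gcongr
        exact hW x
      · refine (hfin ε⁻¹ (ENNReal.inv_ne_top.2 hε0)).subset fun x hx => ?_
        have h2 : ε * W x < 1 := lt_of_le_of_lt le_add_self hx
        change W x < ε⁻¹
        rw [mul_comm] at h2
        exact (ENNReal.lt_div_iff_mul_lt (Or.inl hε0) (Or.inl hε)).2 h2 |>.trans_eq (one_div _)
    refine ENNReal.le_of_forall_pos_le_add fun δ hδ _ => ?_
    by_cases hWx : W x = 0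
    · have := key 1 one_ne_zero ENNReal.one_ne_top
      rw [hWx, mul_zero, add_zero] at this
      exact this.trans le_self_add
    · have hδ0 : (δ : ℝ≥0∞) ≠ 0 := by simpa using hδ.ne'
      have := key (δ / W x) (ENNReal.div_ne_zero.2 ⟨hδ0, hWtop x⟩)
        (ENNReal.div_ne_top ENNReal.coe_ne_top hWx)
      rwa [ENNReal.div_mul_cancel hWx (hWtop x)] at this

/-- The Foster criterion: if the drift of `V ≥ 0` is at most `-δ` outside a finite set, then the
resolvents `r (r - q)⁻¹`, `r → 0`, keep a positive mass in this set, and their limit points satisfy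
the balance equations. -/
lemma exists_isBalanced [Nonempty S]
    (hcol : ∀ y, {x | jumpRate q x y ≠ 0}.Finite)
    (hR : ∀ r : ℝ≥0∞, r ≠ 0 → r ≠ ∞ → ∀ x, ∑' y, resolventKernel q r x y * r = 1)
    {V : S → ℝ≥0∞} (hV : ∀ x, V x ≠ ∞) (F : Finset S) {b δ : ℝ≥0∞} (hb : b ≠ ∞) (hδ : δ ≠ 0)
    (hdrift : ∀ x, δ + ∑' z, jumpRate q x z * V z ≤
      exitRate q x * V x + (if x ∈ F then b else 0)) :
    ∃ π : S → ℝ≥0∞, ∑' x, π x = 1 ∧ IsBalanced q π := by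
  obtain ⟨x₀⟩ := ‹Nonempty S›
  set r : ℕ → ℝ≥0∞ := fun n => ((n : ℝ≥0∞) + 1)⁻¹ with hr
  have hr0 : ∀ n, r n ≠ 0 := fun n => by simp [hr]
  have hrtop : ∀ n, r n ≠ ∞ := fun n => by simp [hr]
  have hrlim : Tendsto r atTop (𝓝 0) := by
    have := ENNReal.tendsto_inv_nat_nhds_zero.comp (tendsto_add_atTop_nat 1)
    refine this.congr fun n => ?_
    simp [hr]
  have hw0 : ∀ n x, r n + exitRate q x ≠ 0 := fun n => add_exitRate_ne_zero (hr0 n)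
  have hw : ∀ n x, r n + exitRate q x ≠ ∞ := fun n => add_exitRate_ne_top (hrtop n)
  set p : ℕ → S → ℝ≥0∞ := fun n y => r n * resolventKernel q (r n) x₀ y with hp
  have hp1 : ∀ n, ∑' y, p n y = 1 := fun n => by
    rw [← hR (r n) (hr0 n) (hrtop n) x₀]
    exact tsum_congr fun y => mul_comm _ _
  -- the forward equation
  have hpbal : ∀ n y, p n y * (r n + exitRate q y) =
      (if x₀ = y then r n else 0) + ∑' z, p n z * jumpRate q z y := by
    intro n y
    have h1 := tsum_mul_potential_mul (a := jumpRate q) (hw0 n) (hw n)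
      (fun x => if x₀ = x then r n else 0) y
    simp only [tsum_ite_eq_mul] at h1
    exact h1
  -- the mass on `F`
  have hpF : ∀ n, δ ≤ r n * V x₀ + b * ∑ y ∈ F, p n y := by
    intro n
    have hsum : ∀ x, ∑' y, resolventKernel q (r n) x y * (if y ∈ F then b else 0) =
        b * ∑ y ∈ F, resolventKernel q (r n) x y := by
      intro x
      rw [tsum_eq_sum (s := F) (fun y hy => by simp [hy]), Finset.mul_sum]
      exact Finset.sum_congr rfl fun y hy => by rw [if_pos hy, mul_comm]
    have h1 := tsum_potential_le (a := jumpRate q) (hw0 n) (hw n) (fun _ => δ)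
      (fun x => V x + b * ∑ y ∈ F, resolventKernel q (r n) x y) (fun x => ?_) x₀
    · change ∑' y, resolventKernel q (r n) x₀ y * δ ≤ _ at h1
      have h2 : r n * ∑' y, resolventKernel q (r n) x₀ y * δ = δ := by
        rw [ENNReal.tsum_mul_right, ← mul_assoc, mul_comm (r n), ← ENNReal.tsum_mul_right,
          hR _ (hr0 n) (hrtop n), one_mul]
      calc δ = r n * ∑' y, resolventKernel q (r n) x₀ y * δ := h2.symm
        _ ≤ r n * (V x₀ + b * ∑ y ∈ F, resolventKernel q (r n) x₀ y) := by gcongr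
        _ = _ := by
            rw [mul_add, mul_left_comm, Finset.mul_sum]
    · have h3 := mul_tsum_potential (a := jumpRate q) (hw0 n) (hw n)
        (fun y => if y ∈ F then b else 0) x
      change _ * ∑' y, resolventKernel q (r n) x y * _ =
        _ + ∑' z, jumpRate q x z * ∑' y, resolventKernel q (r n) z y * _ at h3
      simp only [hsum] at h3
      simp only [mul_add]
      rw [ENNReal.tsum_add, h3, ← add_assoc, ← add_assoc, add_mul]
      refine add_le_add ((hdrift x).trans ?_) le_rfl
      gcongr
      exact le_add_self
  -- a limit point
  set U : Ultrafilter (S → ℝ≥0∞) := (Filter.hyperfilter ℕ).map p with hU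
  set ρ : S → ℝ≥0∞ := U.lim with hρ
  have hlim : ∀ y, Tendsto (fun n => p n y) (Filter.hyperfilter ℕ) (𝓝 (ρ y)) := by
    have h1 : Tendsto p (Filter.hyperfilter ℕ) (𝓝 ρ) := U.le_nhds_lim
    exact fun y => (tendsto_pi_nhds.1 h1) y
  have hrlim' : Tendsto r (Filter.hyperfilter ℕ) (𝓝 0) :=
    hrlim.mono_left Nat.hyperfilter_le_atTop
  have hρ1 : ∑' y, ρ y ≤ 1 := by
    rw [ENNReal.tsum_eq_iSup_sum]
    refine iSup_le fun G => ?_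
    refine le_of_tendsto' (tendsto_finsetSum G fun y _ => hlim y) fun n => ?_
    exact (ENNReal.sum_le_tsum G).trans (hp1 n).le
  have hρF : δ ≤ b * ∑ y ∈ F, ρ y := by
    have h1 : Tendsto (fun n => r n * V x₀ + b * ∑ y ∈ F, p n y) (Filter.hyperfilter ℕ)
        (𝓝 (0 * V x₀ + b * ∑ y ∈ F, ρ y)) :=
      (ENNReal.Tendsto.mul_const hrlim' (Or.inr (hV x₀))).add
        (ENNReal.Tendsto.const_mul (tendsto_finsetSum F fun y _ => hlim y) (Or.inr hb))
    rw [zero_mul, zero_add] at h1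
    exact ge_of_tendsto' h1 hpF
  have hρtop : ∀ y, ρ y ≠ ∞ := fun y =>
    ne_top_of_le_ne_top ENNReal.one_ne_top ((ENNReal.le_tsum y).trans hρ1)
  have hρbal : IsBalanced q ρ := by
    intro y
    have hfin : ∀ f : S → ℝ≥0∞, ∑' z, f z * jumpRate q z y =
        ∑ z ∈ (hcol y).toFinset, f z * jumpRate q z y := fun f =>
      tsum_eq_sum fun z hz => by
        have : jumpRate q z y = 0 := by simpa using hz
        rw [this, mul_zero]
    have h1 : Tendsto (fun n => p n y * (r n + exitRate q y)) (Filter.hyperfilter ℕ)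
        (𝓝 (ρ y * (0 + exitRate q y))) :=
      ENNReal.Tendsto.mul (hlim y) (Or.inr (add_exitRate_ne_top ENNReal.zero_ne_top y))
        (hrlim'.add tendsto_const_nhds) (Or.inr (hρtop y))
    have h2 : Tendsto (fun n => (if x₀ = y then r n else 0) + ∑' z, p n z * jumpRate q z y)
        (Filter.hyperfilter ℕ) (𝓝 (0 + ∑' z, ρ z * jumpRate q z y)) := by
      simp only [hfin]
      refine Tendsto.add ?_ (tendsto_finsetSum _ fun z _ =>
        ENNReal.Tendsto.mul_const (hlim z) (Or.inr ?_))
      · split_ifs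
        · exact hrlim'
        · exact tendsto_const_nhds
      · rw [jumpRate]
        split_ifs
        · exact ENNReal.zero_ne_top
        · exact ENNReal.ofReal_ne_top
    simp only [hpbal] at h1
    have h3 := tendsto_nhds_unique h2 h1
    rwa [zero_add, zero_add] at h3
  have hc0 : ∑' y, ρ y ≠ 0 := by
    intro h0
    have : ∑ y ∈ F, ρ y = 0 := le_antisymm ((ENNReal.sum_le_tsum F).trans h0.le) zero_le
    rw [this, mul_zero] at hρF
    exact hδ (le_antisymm hρF zero_le)
  have hctop : ∑' y, ρ y ≠ ∞ := ne_top_of_le_ne_top ENNReal.one_ne_top hρ1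
  refine ⟨fun y => (∑' y, ρ y)⁻¹ * ρ y, ?_, fun y => ?_⟩
  · rw [ENNReal.tsum_mul_left, ENNReal.inv_mul_cancel hc0 hctop]
  · simp only [mul_assoc]
    rw [ENNReal.tsum_mul_left, hρbal y]

/-! ### Stationary distributions of the transition function -/

lemma setLIntegral_exp_mul_exitRate {α : Type*} {q : α → α → ℝ} (hq : ∀ x, q x x ≤ 0) {t : ℝ} (ht : 0 ≤ t) (x : α) :
    ENNReal.ofReal (Real.exp (q x x * t)) + ∫⁻ s in Set.Icc 0 t,
      ENNReal.ofReal (Real.exp (q x x * s)) * exitRate q x = 1 := by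
  have h1 : ∀ s, ENNReal.ofReal (Real.exp (q x x * s)) * exitRate q x =
      ENNReal.ofReal (Real.exp (q x x * s) * (-q x x)) := fun s =>
    (ENNReal.ofReal_mul (Real.exp_nonneg _)).symm
  have hcont : Continuous fun s => Real.exp (q x x * s) * (-q x x) := by fun_prop
  have hint : ∫ s in (0 : ℝ)..t, Real.exp (q x x * s) * (-q x x) = 1 - Real.exp (q x x * t) := by
    rw [intervalIntegral.integral_eq_sub_of_hasDerivAt
      (f := fun s => -Real.exp (q x x * s)) (fun s _ => ?_) (hcont.intervalIntegrable 0 t)]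
    · simp
      ring
    · have := (((hasDerivAt_id s).const_mul (q x x)).exp).fun_neg
      simpa using this
  have hle : Real.exp (q x x * t) ≤ 1 :=
    Real.exp_le_one_iff.2 (mul_nonpos_of_nonpos_of_nonneg (hq x) ht)
  simp only [h1]
  rw [setLIntegral_congr Ioc_ae_eq_Icc.symm, ← ofReal_integral_eq_lintegral_ofReal,
    ← intervalIntegral.integral_of_le ht, hint, ← ENNReal.ofReal_add (Real.exp_nonneg _)
    (sub_nonneg.2 hle)]
  · simp
  · exact hcont.integrableOn_Ioc
  · exact Eventually.of_forall fun s => mul_nonneg (Real.exp_nonneg _) (by simpa using hq x)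

variable [Countable S]

lemma tsum_ctmcTransition_le_one (hq : IsConservativeGenerator q) {t : ℝ} (ht : 0 ≤ t) (x : S) :
    ∑' y, ctmcTransition q t x y ≤ 1 := by
  have key : ∀ N (t : ℝ), 0 ≤ t → ∀ x,
      ∑ n ∈ Finset.range N, ∑' y, ctmcJumpProb q n t x y ≤ 1 := by
    intro N
    induction N with
    | zero => simp
    | succ N ih =>
      intro t ht x
      have h0 : ∑' y, ctmcJumpProb q 0 t x y = ENNReal.ofReal (Real.exp (q x x * t)) := by
        simpa only [ctmcJumpProb, mul_one] using
          tsum_ite_eq_mul (fun _ => 1) (ENNReal.ofReal (Real.exp (q x x * t))) x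
      have hm : ∀ n (z y : S), Measurable fun s => ctmcJumpProb q n (t - s) z y := fun n z y =>
        (measurable_ctmcJumpProb q n z y).comp (measurable_const.sub measurable_id)
      have h1 : ∀ n, ∑' y, ctmcJumpProb q (n + 1) t x y = ∫⁻ s in Set.Icc 0 t,
          ENNReal.ofReal (Real.exp (q x x * s)) *
            ∑' z, jumpRate q x z * ∑' y, ctmcJumpProb q n (t - s) z y := by
        intro n
        simp only [ctmcJumpProb_succ]
        rw [← lintegral_tsum fun y => by exact ((measurable_exp_ofReal _).mul
          (Measurable.tsum fun z => (hm n z y).const_mul _)).aemeasurable]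
        refine lintegral_congr fun s => ?_
        simp only [← ENNReal.tsum_mul_left]
        rw [ENNReal.tsum_comm]
      rw [Finset.sum_range_succ', h0, add_comm, ← setLIntegral_exp_mul_exitRate hq.diag_nonpos ht x]
      gcongr
      simp only [h1]
      have hm1 : ∀ n, Measurable fun s => ENNReal.ofReal (Real.exp (q x x * s)) *
          ∑' z, jumpRate q x z * ∑' y, ctmcJumpProb q n (t - s) z y := fun n =>
        (measurable_exp_ofReal _).mul
          (Measurable.tsum fun z => (Measurable.tsum fun y => hm n z y).const_mul _)
      rw [← lintegral_finsetSum _ fun n _ => hm1 n]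
      refine setLIntegral_mono ((measurable_exp_ofReal _).mul_const _) fun s hs => ?_
      rw [← Finset.mul_sum, ← Summable.tsum_finsetSum (fun _ _ => ENNReal.summable)]
      simp only [← Finset.mul_sum]
      rw [← hq.tsum_jumpRate]
      gcongr with z
      exact mul_le_of_le_one_right zero_le (ih _ (sub_nonneg.2 hs.2) z)
  simp only [ctmcTransition]
  rw [ENNReal.tsum_comm, ENNReal.tsum_eq_iSup_nat]
  exact iSup_le fun N => key N t ht x

/-- The chain has at every positive time a positive probability to be at any state to which a
sequence of possible jumps leads. -/
lemma ctmcTransition_pos {x y : S}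
    (h : Relation.ReflTransGen (fun u v => 0 < jumpRate q u v) x y) {t : ℝ} (ht : 0 < t) :
    0 < ctmcTransition q t x y := by
  suffices h : ∃ n, ∀ t : ℝ, 0 < t → 0 < ctmcJumpProb q n t x y by
    obtain ⟨n, hn⟩ := h
    exact (hn t ht).trans_le (ENNReal.le_tsum n)
  clear ht t
  induction h using Relation.ReflTransGen.head_induction_on with
  | refl => exact ⟨0, fun t _ => by simp [ctmcJumpProb, Real.exp_pos]⟩
  | @head u v huv _ ih =>
    obtain ⟨n, hn⟩ := ih
    refine ⟨n + 1, fun t ht => ?_⟩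
    have hm : Measurable fun s => ENNReal.ofReal (Real.exp (q u u * s)) *
        ∑' z, jumpRate q u z * ctmcJumpProb q n (t - s) z y :=
      (measurable_exp_ofReal _).mul (Measurable.tsum fun z =>
        ((measurable_ctmcJumpProb q n z y).comp (measurable_const.sub measurable_id)).const_mul _)
    rw [ctmcJumpProb_succ, setLIntegral_pos_iff hm]
    have hsub : Set.Ico 0 t ⊆ Function.support (fun s => ENNReal.ofReal (Real.exp (q u u * s)) *
        ∑' z, jumpRate q u z * ctmcJumpProb q n (t - s) z y) ∩ Set.Icc 0 t := by
      intro s hs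
      refine ⟨?_, hs.1, hs.2.le⟩
      have h1 : 0 < jumpRate q u v * ctmcJumpProb q n (t - s) v y :=
        ENNReal.mul_pos huv.ne' (hn _ (sub_pos.2 hs.2)).ne'
      exact mul_ne_zero (by simp [Real.exp_pos]) (h1.trans_le (ENNReal.le_tsum v)).ne'
    refine lt_of_lt_of_le ?_ (measure_mono hsub)
    simpa using ht

/-- A stationary distribution of the chain is invariant under the resolvent. -/
lemma tsum_mul_resolventKernel_of_stationary (hq : ∀ x, q x x ≤ 0) {π : S → ℝ≥0∞}
    (hπ : IsStationaryDistribution (ctmcTransition q) π) (y : S) :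
    ∑' x, π x * resolventKernel q 1 x y = π y := by
  have he : Measurable fun t : ℝ => ENNReal.ofReal (Real.exp (-t)) := by fun_prop
  have hm : ∀ x, Measurable fun t =>
      ENNReal.ofReal (Real.exp (-t)) * ctmcTransition q t x y := fun x =>
    he.mul (measurable_ctmcTransition q x y)
  simp only [← lintegral_exp_mul_ctmcTransition q hq, ← lintegral_const_mul _ (hm _)]
  rw [← lintegral_tsum fun x => ((hm x).const_mul _).aemeasurable]
  have h1 : ∀ t ∈ Set.Ici (0 : ℝ), ∑' x, π x * (ENNReal.ofReal (Real.exp (-t)) *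
      ctmcTransition q t x y) = ENNReal.ofReal (Real.exp (-t)) * π y := by
    intro t ht
    simp only [mul_left_comm (π _)]
    rw [ENNReal.tsum_mul_left, hπ.2 t ht]
  rw [setLIntegral_congr_fun measurableSet_Ici h1, lintegral_mul_const _ he]
  have := lintegral_exp_neg zero_lt_one
  simp only [neg_mul, one_mul, ENNReal.ofReal_one, inv_one] at this
  rw [this, one_mul]

lemma resolventKernel_comm (hq : ∀ x, q x x ≤ 0) {t : ℝ} (ht : 0 ≤ t) (x y : S) :
    ∑' z, resolventKernel q 1 x z * ctmcTransition q t z y =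
      ∑' z, ctmcTransition q t x z * resolventKernel q 1 z y := by
  have he : Measurable fun t : ℝ => ENNReal.ofReal (Real.exp (-t)) := by fun_prop
  have hm : ∀ x y, Measurable fun t =>
      ENNReal.ofReal (Real.exp (-t)) * ctmcTransition q t x y := fun x y =>
    he.mul (measurable_ctmcTransition q x y)
  simp only [← lintegral_exp_mul_ctmcTransition q hq, ← lintegral_const_mul _ (hm _ _),
    ← lintegral_mul_const _ (hm _ _)]
  rw [← lintegral_tsum fun z => ((hm x z).mul_const _).aemeasurable,
    ← lintegral_tsum fun z => ((hm z y).const_mul _).aemeasurable]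
  refine setLIntegral_congr_fun measurableSet_Ici fun s hs => ?_
  simp only [mul_left_comm (ctmcTransition q t x _), mul_assoc, ENNReal.tsum_mul_left]
  rw [← ctmcTransition_add q hs ht, ← ctmcTransition_add q ht hs, add_comm]

/-- If the resolvent is stochastic, then so are the transition functions. -/
lemma tsum_ctmcTransition_eq_one (hq : IsConservativeGenerator q)
    (hR : ∀ x, ∑' y, resolventKernel q 1 x y = 1) {t : ℝ} (ht : 0 ≤ t) (x : S) :
    ∑' y, ctmcTransition q t x y = 1 := by
  refine le_antisymm (tsum_ctmcTransition_le_one hq ht x) ?_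
  by_contra hlt
  rw [not_le] at hlt
  -- the mass decreases with time, and its Laplace transform shows that it is `1` almost always
  set m : ℝ → ℝ≥0∞ := fun t => ∑' y, ctmcTransition q t x y with hm
  have hmm : Measurable m := Measurable.tsum fun y => measurable_ctmcTransition q x y
  have he : Measurable fun t : ℝ => ENNReal.ofReal (Real.exp (-t)) := by fun_prop
  have hanti : ∀ s, t ≤ s → m s < 1 := by
    intro s hs
    refine lt_of_le_of_lt ?_ hlt
    have h0 : 0 ≤ s - t := sub_nonneg.2 hs
    have h1 : ∀ y, ctmcTransition q s x y =
        ∑' z, ctmcTransition q t x z * ctmcTransition q (s - t) z y := by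
      intro y
      rw [← ctmcTransition_add q ht h0, add_sub_cancel]
    simp only [hm, h1]
    rw [ENNReal.tsum_comm]
    refine ENNReal.tsum_le_tsum fun z => ?_
    rw [ENNReal.tsum_mul_left]
    exact mul_le_of_le_one_right zero_le (tsum_ctmcTransition_le_one hq h0 z)
  have hint : ∫⁻ s in Set.Ici 0, ENNReal.ofReal (Real.exp (-s)) * m s = 1 := by
    rw [← hR x]
    simp only [hm, ← ENNReal.tsum_mul_left, ← lintegral_exp_mul_ctmcTransition q hq.diag_nonpos]
    exact lintegral_tsum fun y => by exact (he.mul (measurable_ctmcTransition q x y)).aemeasurable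
  have hint1 : ∫⁻ s in Set.Ici (0 : ℝ), ENNReal.ofReal (Real.exp (-s)) = 1 := by
    simpa using lintegral_exp_neg zero_lt_one
  have hlt2 : ∫⁻ s in Set.Ici 0, ENNReal.ofReal (Real.exp (-s)) * m s <
      ∫⁻ s in Set.Ici (0 : ℝ), ENNReal.ofReal (Real.exp (-s)) := by
    refine lintegral_strict_mono_of_ae_le_of_ae_lt_on he.aemeasurable
      (by rw [hint]; exact ENNReal.one_ne_top) ?_ (s := Set.Ici t) ?_ ?_
    · filter_upwards [ae_restrict_mem measurableSet_Ici] with s hs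
      exact mul_le_of_le_one_right zero_le (tsum_ctmcTransition_le_one hq hs x)
    · rw [Measure.restrict_apply measurableSet_Ici, Set.inter_eq_left.2 (Set.Ici_subset_Ici.2 ht)]
      simp
    · filter_upwards with s hs
      have hpos : ENNReal.ofReal (Real.exp (-s)) ≠ 0 := by simp [Real.exp_pos]
      calc ENNReal.ofReal (Real.exp (-s)) * m s < ENNReal.ofReal (Real.exp (-s)) * 1 :=
            ENNReal.mul_lt_mul_right hpos ENNReal.ofReal_ne_top (hanti s hs)
        _ = _ := mul_one _
  rw [hint, hint1] at hlt2
  exact lt_irrefl _ hlt2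

/-- An irreducible chain without explosions whose balance equations have a probability solution is
ergodic. -/
theorem isErgodic_of_isBalanced (hq : IsConservativeGenerator q)
    (hirr : ∀ x y, Relation.ReflTransGen (fun u v => 0 < jumpRate q u v) x y)
    (hR : ∀ x, ∑' y, resolventKernel q 1 x y = 1) {π : S → ℝ≥0∞} (hπ1 : ∑' x, π x = 1)
    (hπ : IsBalanced q π) :
    IsErgodic (ctmcTransition q) ∧ ∀ ν : S → ℝ≥0∞, ∑' x, ν x = 1 → IsBalanced q ν → ν = π := by
  have hRpos : ∀ x y, 0 < resolventKernel q 1 x y := fun x y =>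
    potential_pos (add_exitRate_ne_zero one_ne_zero) (add_exitRate_ne_top ENNReal.one_ne_top)
      (hirr x y)
  have hPone : ∀ t, 0 ≤ t → ∀ x, ∑' y, ctmcTransition q t x y = 1 := fun t ht x =>
    tsum_ctmcTransition_eq_one hq hR ht x
  have hπR := hπ.tsum_mul_resolventKernel hπ1 hR
  have huniq : ∀ ν : S → ℝ≥0∞, ∑' x, ν x = 1 →
      (∀ y, ∑' x, ν x * resolventKernel q 1 x y = ν y) → ν = π := fun ν hν1 hν =>
    invariant_unique hR hRpos hπ1 hν1 hπR hν
  -- `π P(t)` is invariant under the resolvent as well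
  have hstat : IsStationaryDistribution (ctmcTransition q) π := by
    refine ⟨hπ1, fun t ht => congrFun (huniq (fun y => ∑' x, π x * ctmcTransition q t x y) ?_ ?_)⟩
    · rw [ENNReal.tsum_comm]
      simp only [ENNReal.tsum_mul_left, hPone t ht, mul_one, hπ1]
    · intro y
      calc ∑' z, (∑' x, π x * ctmcTransition q t x z) * resolventKernel q 1 z y
          = ∑' x, π x * ∑' z, ctmcTransition q t x z * resolventKernel q 1 z y := by
            simp only [← ENNReal.tsum_mul_left, ← ENNReal.tsum_mul_right]
            rw [ENNReal.tsum_comm]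
            simp only [mul_assoc]
        _ = ∑' x, π x * ∑' z, resolventKernel q 1 x z * ctmcTransition q t z y := by
            simp only [resolventKernel_comm hq.diag_nonpos ht]
        _ = ∑' z, (∑' x, π x * resolventKernel q 1 x z) * ctmcTransition q t z y := by
            simp only [← ENNReal.tsum_mul_left, ← ENNReal.tsum_mul_right]
            rw [ENNReal.tsum_comm]
            simp only [mul_assoc]
        _ = _ := by simp only [hπR]
  have hπpos := fun y => hπ.pos hπ1 hirr y
  refine ⟨⟨π, hstat, fun ν hν => huniq ν hν.1
    (tsum_mul_resolventKernel_of_stationary hq.diag_nonpos hν), hπpos, ?_⟩, fun ν hν1 hν =>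
    huniq ν hν1 (hν.tsum_mul_resolventKernel hν1 hR)⟩
  exact tendsto_stationary hPone (fun s t hs ht => ctmcTransition_add q hs ht)
    (fun x y => ctmcTransition_pos (hirr x y) one_pos) hπpos hstat

end Chains

/-! ### Stationary probability vectors and real-valued balance equations -/

section Vectors

variable {S : Type*} [DecidableEq S] {q : S → S → ℝ}

lemma IsStationaryVector.isBalanced (hq : IsConservativeGenerator q) {π : S → ℝ}
    (hπ : IsStationaryVector q π) :
    ∑' x, ENNReal.ofReal (π x) = 1 ∧ IsBalanced q fun x => ENNReal.ofReal (π x) := by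
  obtain ⟨h0, h1, hbal⟩ := hπ
  refine ⟨?_, fun y => ?_⟩
  · rw [← ENNReal.ofReal_tsum_of_nonneg h0 h1.summable, h1.tsum_eq, ENNReal.ofReal_one]
  · have hs := (hbal y).update y 0
    have hnn : ∀ x, 0 ≤ Function.update (fun x => π x * q x y) y 0 x := by
      intro x
      by_cases hx : x = y
      · simp [hx]
      · simp only [Function.update_of_ne hx]
        exact mul_nonneg (h0 x) (hq.offDiag_nonneg x y hx)
    have hterm : ∀ x, ENNReal.ofReal (π x) * jumpRate q x y =
        ENNReal.ofReal (Function.update (fun x => π x * q x y) y 0 x) := by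
      intro x
      by_cases hx : x = y
      · simp [jumpRate, hx]
      · simp only [Function.update_of_ne hx, jumpRate, if_neg (Ne.symm hx)]
        rw [ENNReal.ofReal_mul (h0 x)]
    simp only [hterm]
    rw [← ENNReal.ofReal_tsum_of_nonneg hnn hs.summable, hs.tsum_eq, exitRate,
      ← ENNReal.ofReal_mul (h0 y)]
    congr 1
    ring

lemma IsBalanced.isStationaryVector (hq : IsConservativeGenerator q) {π : S → ℝ≥0∞}
    (hπ1 : ∑' x, π x = 1) (hπ : IsBalanced q π) :
    IsStationaryVector q fun x => (π x).toReal := by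
  have htop := ne_top_of_tsum_eq_one hπ1
  refine ⟨fun x => ENNReal.toReal_nonneg, ?_, fun y => ?_⟩
  · have := ENNReal.hasSum_toReal (f := π) (by rw [hπ1]; exact ENNReal.one_ne_top)
    rwa [← ENNReal.tsum_toReal_eq htop, hπ1, ENNReal.toReal_one] at this
  · have hfin : ∑' x, π x * jumpRate q x y ≠ ∞ := by
      rw [hπ y]
      exact ENNReal.mul_ne_top (htop y) ENNReal.ofReal_ne_top
    have hs := ENNReal.hasSum_toReal hfin
    rw [← ENNReal.tsum_toReal_eq fun x => ne_top_of_le_ne_top hfin (ENNReal.le_tsum x), hπ y] at hs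
    have hs' := hs.update y ((π y).toReal * q y y)
    have hexit : (exitRate q y).toReal = -q y y :=
      ENNReal.toReal_ofReal (neg_nonneg.2 (hq.diag_nonpos y))
    have hval : (π y).toReal * q y y - (π y * jumpRate q y y).toReal +
        (π y * exitRate q y).toReal = 0 := by
      simp [jumpRate, hexit]
    rw [hval] at hs'
    refine hs'.congr_fun fun x => ?_
    by_cases hx : x = y
    · simp [hx]
    · simp only [Function.update_of_ne hx, jumpRate, if_neg (Ne.symm hx), ENNReal.toReal_mul]
      rw [ENNReal.toReal_ofReal (hq.offDiag_nonneg x y hx)]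

lemma tsum_eq_sum_add_tsum_ite (B : Finset S) (f : S → ℝ≥0∞) :
    ∑' x, f x = ∑ x ∈ B, f x + ∑' x, (if x ∈ B then 0 else f x) := by
  have h1 : ∑' x, (if x ∈ B then f x else 0) = ∑ x ∈ B, f x := by
    rw [tsum_eq_sum (s := B) fun x hx => if_neg hx]
    exact Finset.sum_congr rfl fun x hx => if_pos hx
  rw [← h1, ← ENNReal.tsum_add]
  refine tsum_congr fun x => ?_
  split_ifs <;> simp

/-- Under the balance equations, the probability flows out of and into a finite set agree. -/
lemma IsBalanced.flow_eq (hq : IsConservativeGenerator q) {π : S → ℝ≥0∞} (hπ1 : ∑' x, π x = 1)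
    (hπ : IsBalanced q π) (B : Finset S) :
    ∑ x ∈ B, π x * ∑' z, (if z ∈ B then 0 else jumpRate q x z) =
      ∑ y ∈ B, ∑' x, (if x ∈ B then 0 else π x * jumpRate q x y) := by
  have h1 : ∑ x ∈ B, π x * exitRate q x = ∑ x ∈ B, ∑ z ∈ B, π x * jumpRate q x z +
      ∑ x ∈ B, π x * ∑' z, (if z ∈ B then 0 else jumpRate q x z) := by
    rw [← Finset.sum_add_distrib]
    refine Finset.sum_congr rfl fun x _ => ?_
    rw [← Finset.mul_sum, ← mul_add, ← tsum_eq_sum_add_tsum_ite, hq.tsum_jumpRate]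
  have h2 : ∑ x ∈ B, π x * exitRate q x = ∑ x ∈ B, ∑ z ∈ B, π x * jumpRate q x z +
      ∑ y ∈ B, ∑' x, (if x ∈ B then 0 else π x * jumpRate q x y) := by
    rw [Finset.sum_comm, ← Finset.sum_add_distrib]
    refine Finset.sum_congr rfl fun y _ => ?_
    rw [← hπ y, ← tsum_eq_sum_add_tsum_ite]
  have hfin : ∑ x ∈ B, ∑ z ∈ B, π x * jumpRate q x z ≠ ∞ := by
    have : ∑ x ∈ B, π x * exitRate q x ≠ ∞ := (ENNReal.sum_lt_top.2 fun x _ =>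
      (ENNReal.mul_ne_top (ne_top_of_tsum_eq_one hπ1 x) ENNReal.ofReal_ne_top).lt_top).ne
    refine ne_top_of_le_ne_top this ?_
    rw [h1]
    exact le_self_add
  exact (ENNReal.add_right_inj hfin).1 (h1.symm.trans h2)

end Vectors

/-! ### The rates of the queue -/

namespace BMAP

variable {d : ℕ} (A : BMAP d)

/-- The rate of the batches of size `m + 1` in phase `i`. -/
noncomputable def batchRate (i : Fin d) (m : ℕ) : ℝ≥0∞ :=
  ∑ j, ENNReal.ofReal (A.D (m + 1) i j)

lemma batchRate_eq (i : Fin d) (m : ℕ) :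
    A.batchRate i m = ENNReal.ofReal (∑ j, A.D (m + 1) i j) :=
  (ENNReal.ofReal_sum_of_nonneg fun j _ => A.nonneg_of_pos _ (Nat.le_add_left 1 m) i j).symm

/-- The three kinds of jumps: services, phase changes without arrivals, and arrivals. -/
lemma tsum_jumpRate_mul (μ : ℝ) (k : ℕ) (i : Fin d) (g : ℕ × Fin d → ℝ≥0∞) :
    ∑' y, jumpRate (A.queueGenerator μ) (k, i) y * g y =
      ENNReal.ofReal (k * μ) * g (k - 1, i) +
        ∑ j, (if j = i then 0 else ENNReal.ofReal (A.D 0 i j)) * g (k, j) +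
        ∑' m, ∑ j, ENNReal.ofReal (A.D (m + 1) i j) * g (k + (m + 1), j) := by
  have hsplit : ∀ y : ℕ × Fin d, jumpRate (A.queueGenerator μ) (k, i) y * g y =
      (if y = (k - 1, i) then ENNReal.ofReal (k * μ) * g y else 0) +
      (if y.1 = k then (if y.2 = i then 0 else ENNReal.ofReal (A.D 0 i y.2)) * g y else 0) +
      (if k < y.1 then ENNReal.ofReal (A.D (y.1 - k) i y.2) * g y else 0) := by
    rintro ⟨l, j⟩
    simp only [jumpRate, queueGenerator, Prod.mk.injEq]
    rcases lt_trichotomy l k with hlt | rfl | hgt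
    · have h1 : ¬ l = k := hlt.ne
      have h2 : ¬ k < l := hlt.not_gt
      by_cases hl : l + 1 = k
      · have hl' : l = k - 1 := by omega
        by_cases hj : i = j
        · subst hj
          simp [h1, h2, hl, hl'.symm]
        · simp [h1, h2, hl, hj, Ne.symm hj]
      · have hl' : ¬ l = k - 1 := by omega
        simp [h1, h2, hl, hl']
    · by_cases hj : j = i
      · subst hj
        rcases Nat.eq_zero_or_pos l with rfl | hl
        · simp
        · have hl' : ¬ l = l - 1 := by omega
          simp [hl']
      · simp [hj, Ne.symm hj]
    · have h1 : ¬ l = k := hgt.ne'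
      have h2 : ¬ l + 1 = k := by omega
      have h3 : ¬ l = k - 1 := by omega
      simp [h1, h2, h3, hgt]
  simp only [hsplit]
  rw [ENNReal.tsum_add, ENNReal.tsum_add]
  congr 1
  · congr 1
    · exact tsum_ite_eq (k - 1, i) _
    · rw [ENNReal.tsum_prod (f := fun l j => if l = k then
        (if j = i then 0 else ENNReal.ofReal (A.D 0 i j)) * g (l, j) else 0),
        tsum_eq_single k fun l hl => by simp [hl]]
      simp [tsum_fintype]
  · rw [ENNReal.tsum_prod (f := fun l j => if k < l then
      ENNReal.ofReal (A.D (l - k) i j) * g (l, j) else 0)]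
    have hinj : Function.Injective fun m : ℕ => k + (m + 1) := fun m n h => by
      simpa using h
    rw [← hinj.tsum_eq]
    · refine tsum_congr fun m => ?_
      rw [tsum_fintype]
      refine Finset.sum_congr rfl fun j _ => ?_
      rw [if_pos (by omega), Nat.add_sub_cancel_left]
    · intro l hl
      by_contra hne
      refine hl ?_
      have : ¬ k < l := fun hkl => hne ⟨l - k - 1, by simp only; omega⟩
      simp [this]

lemma diag_zero_eq (i : Fin d) : -A.D 0 i i =
    ∑ j, (if j = i then 0 else A.D 0 i j) + ∑ j, ∑' m, A.D (m + 1) i j := by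
  have h1 := A.rowSum_eq_zero i
  have h2 : ∀ j, ∑' k, A.D k i j = A.D 0 i j + ∑' m, A.D (m + 1) i j := fun j =>
    (A.summable i j).tsum_eq_zero_add
  simp only [h2, Finset.sum_add_distrib] at h1
  have h3 : ∑ j, A.D 0 i j = A.D 0 i i + ∑ j, (if j = i then 0 else A.D 0 i j) := by
    rw [← Finset.add_sum_erase _ _ (Finset.mem_univ i), Finset.sum_ite, Finset.sum_const_zero,
      zero_add]
    congr 2
    ext j
    simp
  linarith

lemma tsum_batchRate (i : Fin d) :
    ∑' m, A.batchRate i m = ENNReal.ofReal (∑ j, ∑' m, A.D (m + 1) i j) := by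
  have hnn : ∀ m j, 0 ≤ A.D (m + 1) i j := fun m j => A.nonneg_of_pos _ (Nat.le_add_left 1 m) i j
  rw [ENNReal.ofReal_sum_of_nonneg fun j _ => tsum_nonneg fun m => hnn m j]
  simp only [batchRate]
  rw [Summable.tsum_finsetSum fun _ _ => ENNReal.summable]
  refine Finset.sum_congr rfl fun j _ => ?_
  exact (ENNReal.ofReal_tsum_of_nonneg (fun m => hnn m j)
    ((summable_nat_add_iff 1).2 (A.summable i j))).symm

variable {μ : ℝ}

lemma isConservativeGenerator (hμ : 0 < μ) : IsConservativeGenerator (A.queueGenerator μ) := by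
  have hnn : ∀ m i j, 0 ≤ A.D (m + 1) i j := fun m i j =>
    A.nonneg_of_pos _ (Nat.le_add_left 1 m) i j
  have hoff : ∀ i j, 0 ≤ if j = i then 0 else A.D 0 i j := fun i j => by
    split_ifs with h
    · exact le_rfl
    · exact A.nonneg_offDiag i j (Ne.symm h)
  have hs1 : ∀ i, 0 ≤ ∑ j, (if j = i then 0 else A.D 0 i j) := fun i =>
    Finset.sum_nonneg fun j _ => hoff i j
  have hs2 : ∀ i, 0 ≤ ∑ j, ∑' m, A.D (m + 1) i j := fun i =>
    Finset.sum_nonneg fun j _ => tsum_nonneg fun m => hnn m i j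
  have hdiag : ∀ k i, A.queueGenerator μ (k, i) (k, i) = A.D 0 i i - k * μ := fun k i => by
    simp [queueGenerator]
  have hkμ : ∀ k : ℕ, 0 ≤ (k : ℝ) * μ := fun k => mul_nonneg (Nat.cast_nonneg k) hμ.le
  refine ⟨fun ⟨k, i⟩ => ?_, fun ⟨k, i⟩ ⟨l, j⟩ hne => ?_, fun ⟨k, i⟩ => ?_⟩
  · rw [hdiag]
    linarith [A.diag_zero_eq i, hs1 i, hs2 i, hkμ k]
  · simp only [queueGenerator]
    split_ifs with h1 h2 h3 h4 h5
    · exact hkμ k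
    · exact le_rfl
    · exact absurd (Prod.ext h3.symm h4) hne
    · rw [sub_zero]
      exact A.nonneg_offDiag i j h4
    · exact A.nonneg_of_pos _ (by omega) i j
    · exact le_rfl
  · have h1 := A.tsum_jumpRate_mul μ k i fun _ => 1
    simp only [mul_one] at h1
    rw [h1]
    change _ + _ + ∑' m, A.batchRate i m = _
    have h2 : ∑ j, (if j = i then 0 else ENNReal.ofReal (A.D 0 i j)) =
        ENNReal.ofReal (∑ j, (if j = i then 0 else A.D 0 i j)) := by
      rw [ENNReal.ofReal_sum_of_nonneg fun j _ => hoff i j]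
      refine Finset.sum_congr rfl fun j _ => ?_
      split_ifs <;> simp
    rw [h2, tsum_batchRate, exitRate, hdiag, ← ENNReal.ofReal_add (hkμ k) (hs1 i),
      ← ENNReal.ofReal_add (add_nonneg (hkμ k) (hs1 i)) (hs2 i)]
    congr 1
    linarith [A.diag_zero_eq i]

/-- A state is entered from finitely many states only, since levels drop by at most one. -/
lemma finite_jumpRate_ne_zero (μ : ℝ) (y : ℕ × Fin d) :
    {x | jumpRate (A.queueGenerator μ) x y ≠ 0}.Finite := by
  refine Set.Finite.subset ((Finset.range (y.1 + 2) ×ˢ Finset.univ).finite_toSet) fun x hx => ?_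
  simp only [Finset.coe_product, Finset.coe_univ, Set.mem_prod, Set.mem_univ, and_true,
    Finset.coe_range, Set.mem_Iio]
  by_contra hlt
  refine hx ?_
  have h1 : ¬ y.1 + 1 = x.1 := by omega
  have h2 : ¬ y.1 = x.1 := by omega
  have h3 : ¬ x.1 < y.1 := by omega
  simp [jumpRate, queueGenerator, h1, h2, h3]

/-! ### Irreducibility of the queue -/

lemma reach_add {k n : ℕ} {a b : Fin d} (hD : 0 < A.D k a b) (hne : (n, a) ≠ (n + k, b)) :
    0 < jumpRate (A.queueGenerator μ) (n, a) (n + k, b) := by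
  rw [jumpRate, if_neg (Ne.symm hne), ENNReal.ofReal_pos]
  rcases Nat.eq_zero_or_pos k with rfl | hk
  · have hab : a ≠ b := fun h => hne (by simp [h])
    simpa [queueGenerator, hab] using hD
  · have h1 : ¬ n + k + 1 = n := by omega
    have h2 : ¬ k = 0 := by omega
    simpa [queueGenerator, h1, h2, hk] using hD

lemma reach_down (hμ : 0 < μ) {l k : ℕ} (h : l ≤ k) (i : Fin d) : Relation.ReflTransGen
    (fun u v => 0 < jumpRate (A.queueGenerator μ) u v) (k, i) (l, i) := by
  induction h with
  | refl => exact Relation.ReflTransGen.refl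
  | @step k _ ih =>
    refine Relation.ReflTransGen.head ?_ ih
    have h1 : ((k + 1 : ℕ) : ℝ) * μ > 0 := by positivity
    rw [jumpRate, if_neg (by simp), ENNReal.ofReal_pos]
    simpa [queueGenerator] using h1

/-- Every phase can be reached, at the expense of additional arrivals. -/
lemma reach_phase (n : ℕ) (a b : Fin d) : ∃ m, n ≤ m ∧ Relation.ReflTransGen
    (fun u v => 0 < jumpRate (A.queueGenerator μ) u v) (n, a) (m, b) := by
  induction A.irreducible a b with
  | refl => exact ⟨n, le_rfl, Relation.ReflTransGen.refl⟩
  | @tail b c _ hbc ih =>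
    obtain ⟨m, hm, hr⟩ := ih
    obtain ⟨k, hk⟩ : ∃ k, 0 < A.D k b c := by
      by_contra hno
      simp only [not_exists, not_lt] at hno
      exact absurd hbc (not_lt.2 (tsum_nonpos hno))
    by_cases hne : (m, b) = (m + k, c)
    · exact ⟨m + k, by omega, hne ▸ hr⟩
    · exact ⟨m + k, by omega, hr.tail (A.reach_add hk hne)⟩

lemma reach (hμ : 0 < μ) (x y : ℕ × Fin d) : Relation.ReflTransGen
    (fun u v => 0 < jumpRate (A.queueGenerator μ) u v) x y := by
  obtain ⟨k, i⟩ := x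
  obtain ⟨l, j⟩ := y
  -- a phase in which customers arrive
  obtain ⟨i₀, m, j₀, hD⟩ : ∃ i₀ m j₀, 0 < A.D (m + 1) i₀ j₀ := by
    by_contra hno
    simp only [not_exists, not_lt] at hno
    refine A.nontrivial (funext fun i => ?_)
    have : ∀ m j, A.D (m + 1) i j = 0 := fun m j =>
      le_antisymm (hno i m j) (A.nonneg_of_pos _ (Nat.le_add_left 1 m) i j)
    simp [this]
  have hup : ∀ l, ∃ m, l ≤ m ∧ Relation.ReflTransGen
      (fun u v => 0 < jumpRate (A.queueGenerator μ) u v) (k, i) (m, i) := by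
    intro l
    induction l with
    | zero => exact ⟨k, Nat.zero_le k, Relation.ReflTransGen.refl⟩
    | succ l ih =>
      obtain ⟨m₁, h₁, r₁⟩ := ih
      obtain ⟨m₂, h₂, r₂⟩ := A.reach_phase (μ := μ) m₁ i i₀
      obtain ⟨m₃, h₃, r₃⟩ := A.reach_phase (μ := μ) (m₂ + (m + 1)) j₀ i
      refine ⟨m₃, by omega, ((r₁.trans r₂).tail (A.reach_add hD ?_)).trans r₃⟩
      intro h
      have := congrArg Prod.fst h
      simp only at this
      omega
  obtain ⟨m₁, h₁, r₁⟩ := hup l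
  obtain ⟨m₂, h₂, r₂⟩ := A.reach_phase (μ := μ) m₁ i j
  exact (r₁.trans r₂).trans (A.reach_down hμ (h₁.trans h₂) j)

/-! ### The harmonic moment of the batch sizes -/

/-- The harmonic number `1 + 1/2 + ⋯ + 1/k`. -/
noncomputable def harmonicSum (k : ℕ) : ℝ≥0∞ :=
  ∑ n ∈ Finset.range k, ((n : ℝ≥0∞) + 1)⁻¹

lemma harmonicSum_eq (k : ℕ) : harmonicSum k = ENNReal.ofReal (harmonic k : ℝ) := by
  rw [harmonicSum, harmonic, Rat.cast_sum, ENNReal.ofReal_sum_of_nonneg fun n _ => by positivity]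
  refine Finset.sum_congr rfl fun n _ => ?_
  have h1 : (((n + 1 : ℕ) : ℚ)⁻¹ : ℚ) = (((n : ℝ) + 1)⁻¹ : ℝ) := by push_cast; rfl
  rw [h1, ENNReal.ofReal_inv_of_pos (by positivity), ENNReal.ofReal_add (by positivity) zero_le_one]
  simp

lemma harmonicSum_ne_top (k : ℕ) : harmonicSum k ≠ ∞ := by
  rw [harmonicSum_eq]
  exact ENNReal.ofReal_ne_top

lemma harmonicSum_mono {k l : ℕ} (h : k ≤ l) : harmonicSum k ≤ harmonicSum l :=
  Finset.sum_le_sum_of_subset (Finset.range_mono h)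

lemma exists_le_harmonicSum {c : ℝ≥0∞} (hc : c ≠ ∞) : ∃ k, c ≤ harmonicSum k := by
  obtain ⟨k, hk⟩ := exists_nat_ge (Real.exp c.toReal)
  refine ⟨k, ?_⟩
  rw [harmonicSum_eq, ← ENNReal.ofReal_toReal hc]
  refine ENNReal.ofReal_le_ofReal (le_trans ?_ (log_add_one_le_harmonic k))
  rw [Real.le_log_iff_exp_le (by positivity)]
  push_cast
  linarith

/-- The entry of `∑_{k ≥ 1} H_k D(k) e` at phase `i`, with the harmonic numbers `H_k`. -/
noncomputable def harmonicMoment (i : Fin d) : ℝ≥0∞ :=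
  ∑' m, A.batchRate i m * harmonicSum (m + 1)

lemma sum_batch_nonneg (i : Fin d) (m : ℕ) : 0 ≤ ∑ j, A.D (m + 1) i j :=
  Finset.sum_nonneg fun j _ => A.nonneg_of_pos _ (Nat.le_add_left 1 m) i j

lemma one_le_log_add_exp (m : ℕ) : 1 ≤ Real.log (((m + 1 : ℕ) : ℝ) + Real.exp 1) := by
  rw [Real.le_log_iff_exp_le (by positivity)]
  have : (0 : ℝ) ≤ ((m + 1 : ℕ) : ℝ) := Nat.cast_nonneg _
  linarith

lemma logMomentCondition_iff : A.LogMomentCondition ↔ ∀ i, A.harmonicMoment i ≠ ∞ := by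
  set b : Fin d → ℕ → ℝ := fun i m => ∑ j, A.D (m + 1) i j with hb
  set h : ℕ → ℝ := fun m => (harmonic (m + 1) : ℝ) with hh
  set l : ℕ → ℝ := fun m => Real.log (((m + 1 : ℕ) : ℝ) + Real.exp 1) with hl
  have hb0 : ∀ i m, 0 ≤ b i m := A.sum_batch_nonneg
  have hl1 : ∀ m, 1 ≤ l m := one_le_log_add_exp
  have hmom : ∀ i, A.harmonicMoment i = ∑' m, ENNReal.ofReal (b i m * h m) := fun i => by
    refine tsum_congr fun m => ?_
    rw [batchRate_eq, harmonicSum_eq, ENNReal.ofReal_mul (hb0 i m)]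
  have hhl : ∀ m, h m ≤ 2 * l m := by
    intro m
    have h1 : h m ≤ 1 + Real.log ((m + 1 : ℕ) : ℝ) := harmonic_le_one_add_log (m + 1)
    have h2 : Real.log ((m + 1 : ℕ) : ℝ) ≤ l m :=
      Real.log_le_log (by positivity) (by linarith [Real.exp_pos 1])
    linarith [hl1 m]
  have hlh : ∀ m, l m ≤ 2 * h m := by
    intro m
    have h1 : Real.log ((m + 1 + 1 : ℕ) : ℝ) ≤ h m := log_add_one_le_harmonic (m + 1)
    have h2 : l m ≤ 1 + Real.log ((m + 1 + 1 : ℕ) : ℝ) := by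
      rw [← Real.log_exp 1, ← Real.log_mul (Real.exp_pos 1).ne' (by positivity)]
      refine Real.log_le_log (by positivity) ?_
      have he : (1 : ℝ) ≤ Real.exp 1 := Real.one_le_exp zero_le_one
      have hm : (0 : ℝ) ≤ ((m + 1 : ℕ) : ℝ) := Nat.cast_nonneg _
      rw [Nat.cast_add_one (m + 1)]
      nlinarith
    have h3 : (1 : ℝ) ≤ h m := by
      have : (1 : ℚ) ≤ harmonic (m + 1) := by
        rw [harmonic, Finset.sum_range_succ']
        simp only [zero_add, Nat.cast_one, inv_one]
        have : (0 : ℚ) ≤ ∑ k ∈ Finset.range m, (((k + 1 + 1 : ℕ)) : ℚ)⁻¹ :=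
          Finset.sum_nonneg fun k _ => by positivity
        linarith
      change (1 : ℝ) ≤ (harmonic (m + 1) : ℝ)
      exact_mod_cast this
    linarith
  constructor
  · rintro ⟨C, -, hC⟩ i
    have hs : Summable fun m => b i m * h m := by
      refine Summable.of_nonneg_of_le (fun m => mul_nonneg (hb0 i m) ?_) (fun m => ?_)
        ((hC i).1.mul_left 2)
      · linarith [hlh m, hl1 m]
      · have := mul_le_mul_of_nonneg_left (hhl m) (hb0 i m)
        change b i m * h m ≤ 2 * (l m * b i m)
        linarith
    rw [hmom]
    exact hs.tsum_ofReal_ne_top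
  · intro hfin
    have hs : ∀ i, Summable fun m => l m * b i m := by
      intro i
      have h1 := ENNReal.summable_toReal (by rw [← hmom]; exact hfin i)
      refine Summable.of_nonneg_of_le (fun m => mul_nonneg (zero_le_one.trans (hl1 m)) (hb0 i m))
        (fun m => ?_) (h1.mul_left 2)
      have h2 : 0 ≤ b i m * h m := mul_nonneg (hb0 i m) (by linarith [hlh m, hl1 m])
      rw [ENNReal.toReal_ofReal h2]
      have := mul_le_mul_of_nonneg_right (hlh m) (hb0 i m)
      linarith
    have hnn : ∀ i, 0 ≤ ∑' m, l m * b i m := fun i =>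
      tsum_nonneg fun m => mul_nonneg (zero_le_one.trans (hl1 m)) (hb0 i m)
    refine ⟨1 + ∑ i, ∑' m, l m * b i m, ?_, fun i => ⟨hs i, ?_⟩⟩
    · linarith [Finset.sum_nonneg fun i (_ : i ∈ Finset.univ) => hnn i]
    · change ∑' m, l m * b i m ≤ _
      linarith [Finset.single_le_sum (fun i _ => hnn i) (Finset.mem_univ i)]

/-! ### Necessity of the logarithmic moment -/

/-- Batches that lead from level `0` beyond level `n` are balanced by the services at level
`n + 1`. -/
lemma mul_tail_le (hμ : 0 < μ) {π : ℕ × Fin d → ℝ≥0∞} (hπ1 : ∑' x, π x = 1)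
    (hπ : IsBalanced (A.queueGenerator μ) π) (i : Fin d) (n : ℕ) :
    π (0, i) * ∑' m, (if n ≤ m then A.batchRate i m else 0) ≤
      ENNReal.ofReal ((n + 1 : ℕ) * μ) * ∑' x : ℕ × Fin d, (if x.1 = n + 1 then π x else 0) := by
  set B : Finset (ℕ × Fin d) := Finset.range (n + 1) ×ˢ Finset.univ with hB
  have hmem : ∀ x : ℕ × Fin d, x ∈ B ↔ x.1 < n + 1 := fun x => by simp [hB]
  have hflow := hπ.flow_eq (A.isConservativeGenerator hμ) hπ1 B
  have hout : ∑' m, (if n ≤ m then A.batchRate i m else 0) ≤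
      ∑' z, (if z ∈ B then 0 else jumpRate (A.queueGenerator μ) (0, i) z) := by
    have h1 := A.tsum_jumpRate_mul μ 0 i fun z => if z ∈ B then 0 else 1
    simp only [mul_ite, mul_zero, mul_one] at h1
    rw [h1]
    refine le_trans (ENNReal.tsum_le_tsum fun m => ?_) le_add_self
    split_ifs with h
    · refine Finset.sum_le_sum fun j _ => ?_
      rw [if_neg (by rw [hmem]; simp only; omega)]
    · exact zero_le
  have hin : ∀ x, x ∉ B → ∑ y ∈ B, jumpRate (A.queueGenerator μ) x y ≤
      if x.1 = n + 1 then ENNReal.ofReal ((n + 1 : ℕ) * μ) else 0 := by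
    rintro ⟨k, j⟩ hx
    rw [hmem, not_lt] at hx
    simp only at hx
    have h1 := A.tsum_jumpRate_mul μ k j fun z => if z ∈ B then 1 else 0
    have h2 : ∑' y, jumpRate (A.queueGenerator μ) (k, j) y * (if y ∈ B then 1 else 0) =
        ∑ y ∈ B, jumpRate (A.queueGenerator μ) (k, j) y := by
      rw [tsum_eq_sum (s := B) fun y hy => by simp [hy]]
      exact Finset.sum_congr rfl fun y hy => by simp [hy]
    have h3 : ∀ j, (k, j) ∉ B := fun j => by rw [hmem]; simp only; omega
    have h4 : ∀ m j, (k + (m + 1), j) ∉ B := fun m j => by rw [hmem]; simp only; omega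
    rw [← h2, h1]
    simp only [h3, h4, if_false, mul_zero, Finset.sum_const_zero, tsum_zero, add_zero, hmem]
    by_cases hk : k = n + 1
    · simp [hk]
    · rw [if_neg (by omega), mul_zero]
      exact zero_le
  calc π (0, i) * ∑' m, (if n ≤ m then A.batchRate i m else 0)
      ≤ ∑ x ∈ B, π x * ∑' z, (if z ∈ B then 0 else jumpRate (A.queueGenerator μ) x z) := by
        refine le_trans (mul_le_mul' le_rfl hout) (Finset.single_le_sum (f := fun x =>
          π x * ∑' z, (if z ∈ B then 0 else jumpRate (A.queueGenerator μ) x z))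
          (fun _ _ => zero_le) ((hmem (0, i)).2 (Nat.succ_pos n)))
    _ = ∑' x, ∑ y ∈ B, (if x ∈ B then 0 else π x * jumpRate (A.queueGenerator μ) x y) := by
        rw [hflow, Summable.tsum_finsetSum fun _ _ => ENNReal.summable]
    _ ≤ ∑' x, ENNReal.ofReal ((n + 1 : ℕ) * μ) * (if x.1 = n + 1 then π x else 0) := by
        refine ENNReal.tsum_le_tsum fun x => ?_
        by_cases hx : x ∈ B
        · simp [hx]
        · simp only [hx, if_false]
          rw [← Finset.mul_sum]
          refine (mul_le_mul' le_rfl (hin x hx)).trans_eq ?_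
          split_ifs
          · exact mul_comm _ _
          · simp
    _ = _ := ENNReal.tsum_mul_left

/-- Dividing the flow through level `n` by `n + 1` and summing over `n` bounds the harmonic moment
of the batch sizes by the total probability. -/
lemma mul_harmonicMoment_le (hμ : 0 < μ) {π : ℕ × Fin d → ℝ≥0∞} (hπ1 : ∑' x, π x = 1)
    (hπ : IsBalanced (A.queueGenerator μ) π) (i : Fin d) :
    π (0, i) * A.harmonicMoment i ≤ ENNReal.ofReal μ := by
  have h1 : A.harmonicMoment i =
      ∑' n : ℕ, ((n : ℝ≥0∞) + 1)⁻¹ * ∑' m, (if n ≤ m then A.batchRate i m else 0) := by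
    simp only [← ENNReal.tsum_mul_left]
    rw [ENNReal.tsum_comm]
    refine tsum_congr fun m => ?_
    rw [tsum_eq_sum (s := Finset.range (m + 1)) fun n hn => by
      rw [if_neg (by simpa [Nat.lt_succ_iff] using hn), mul_zero], harmonicSum, Finset.mul_sum]
    refine Finset.sum_congr rfl fun n hn => ?_
    rw [if_pos (by simpa [Nat.lt_succ_iff] using hn), mul_comm]
  rw [h1, ← ENNReal.tsum_mul_left]
  calc ∑' n : ℕ, π (0, i) * (((n : ℝ≥0∞) + 1)⁻¹ *
        ∑' m, (if n ≤ m then A.batchRate i m else 0))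
      ≤ ∑' n : ℕ, ENNReal.ofReal μ * ∑' x : ℕ × Fin d, (if x.1 = n + 1 then π x else 0) := by
        refine ENNReal.tsum_le_tsum fun n => ?_
        have h2 : ENNReal.ofReal ((n + 1 : ℕ) * μ) = ((n : ℝ≥0∞) + 1) * ENNReal.ofReal μ := by
          rw [ENNReal.ofReal_mul (Nat.cast_nonneg _), ENNReal.ofReal_natCast, Nat.cast_add_one]
        have h3 := A.mul_tail_le hμ hπ1 hπ i n
        rw [h2] at h3
        rw [mul_left_comm]
        refine (mul_le_mul' le_rfl h3).trans_eq ?_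
        rw [← mul_assoc, ← mul_assoc, ENNReal.inv_mul_cancel (by simp) (by simp), one_mul]
    _ = ENNReal.ofReal μ * ∑' x : ℕ × Fin d, ∑' n : ℕ, (if x.1 = n + 1 then π x else 0) := by
        rw [ENNReal.tsum_mul_left, ENNReal.tsum_comm]
    _ ≤ ENNReal.ofReal μ * ∑' x, π x := by
        gcongr with x
        rw [tsum_eq_single (x.1 - 1) fun n hn => if_neg (by omega)]
        split_ifs
        · exact le_rfl
        · exact zero_le
    _ = ENNReal.ofReal μ := by rw [hπ1, mul_one]

lemma logMomentCondition_of_isBalanced (hμ : 0 < μ) {π : ℕ × Fin d → ℝ≥0∞}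
    (hπ1 : ∑' x, π x = 1) (hπ : IsBalanced (A.queueGenerator μ) π) : A.LogMomentCondition := by
  refine A.logMomentCondition_iff.2 fun i hi => ?_
  have h1 := A.mul_harmonicMoment_le hμ hπ1 hπ i
  rw [hi, ENNReal.mul_top (hπ.pos hπ1 (A.reach hμ) (0, i)).ne'] at h1
  exact absurd h1 (not_le.2 ENNReal.ofReal_lt_top)

/-! ### Sufficiency of the logarithmic moment -/

/-- The contribution of the arrivals to the drift of `(k, i) ↦ H_k`. -/
noncomputable def arrivalDrift (i : Fin d) (k : ℕ) : ℝ≥0∞ :=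
  ∑' m, A.batchRate i m * ∑ n ∈ Finset.range (m + 1), ((k + n : ℕ) + 1 : ℝ≥0∞)⁻¹

lemma sum_jumpRate_harmonicSum (hμ : 0 < μ) (k : ℕ) (i : Fin d) :
    ∑' y, jumpRate (A.queueGenerator μ) (k, i) y * harmonicSum y.1 +
        (if k = 0 then 0 else ENNReal.ofReal μ) =
      exitRate (A.queueGenerator μ) (k, i) * harmonicSum k + A.arrivalDrift i k := by
  have hadd : ∀ m, harmonicSum (k + (m + 1)) = harmonicSum k +
      ∑ n ∈ Finset.range (m + 1), ((k + n : ℕ) + 1 : ℝ≥0∞)⁻¹ := fun m => by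
    simp only [harmonicSum]
    rw [Finset.sum_range_add]
  have hdown : ENNReal.ofReal (k * μ) * harmonicSum (k - 1) +
      (if k = 0 then 0 else ENNReal.ofReal μ) = ENNReal.ofReal (k * μ) * harmonicSum k := by
    cases k with
    | zero => simp
    | succ k =>
      have h2 : ENNReal.ofReal ((k + 1 : ℕ) * μ) = ((k : ℝ≥0∞) + 1) * ENNReal.ofReal μ := by
        rw [ENNReal.ofReal_mul (Nat.cast_nonneg _), ENNReal.ofReal_natCast, Nat.cast_add_one]
      simp only [harmonicSum]
      rw [Finset.sum_range_succ, mul_add, if_neg (Nat.succ_ne_zero k), Nat.add_sub_cancel, h2,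
        mul_right_comm _ (ENNReal.ofReal μ) ((k : ℝ≥0∞) + 1)⁻¹,
        ENNReal.mul_inv_cancel (by simp) (by simp), one_mul]
  have h1 := A.tsum_jumpRate_mul μ k i fun y => harmonicSum y.1
  have h2 := A.tsum_jumpRate_mul μ k i fun _ => harmonicSum k
  rw [ENNReal.tsum_mul_right, (A.isConservativeGenerator hμ).tsum_jumpRate] at h2
  have h3 : ∑' m, ∑ j, ENNReal.ofReal (A.D (m + 1) i j) * harmonicSum (k + (m + 1)) =
      ∑' m, ∑ j, ENNReal.ofReal (A.D (m + 1) i j) * harmonicSum k + A.arrivalDrift i k := by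
    rw [arrivalDrift, ← ENNReal.tsum_add]
    refine tsum_congr fun m => ?_
    rw [← Finset.sum_mul, ← Finset.sum_mul, hadd, mul_add]
    rfl
  simp only at h1
  rw [h1, h2, h3, ← hdown]
  ring

lemma arrivalDrift_le (i : Fin d) (k : ℕ) : A.arrivalDrift i k ≤ A.harmonicMoment i := by
  refine ENNReal.tsum_le_tsum fun m => ?_
  rw [harmonicSum]
  gcongr with n
  omega

lemma batchRate_ne_top (i : Fin d) (m : ℕ) : A.batchRate i m ≠ ∞ := by
  rw [batchRate_eq]
  exact ENNReal.ofReal_ne_top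

/-- The increments of `H` are small at high levels, and are dominated by `H`. -/
lemma tendsto_arrivalDrift {i : Fin d} (hi : A.harmonicMoment i ≠ ∞) :
    Tendsto (A.arrivalDrift i) atTop (𝓝 0) := by
  have hinv : ∀ n : ℕ, Tendsto (fun k : ℕ => ((k + n : ℕ) + 1 : ℝ≥0∞)⁻¹) atTop (𝓝 0) := by
    intro n
    have := ENNReal.tendsto_inv_nat_nhds_zero.comp (tendsto_add_atTop_nat (n + 1))
    refine this.congr fun k => ?_
    simp [add_assoc]
  have hterm : ∀ m, Tendsto (fun k : ℕ => A.batchRate i m *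
      ∑ n ∈ Finset.range (m + 1), ((k + n : ℕ) + 1 : ℝ≥0∞)⁻¹) atTop (𝓝 0) := by
    intro m
    have h1 := ENNReal.Tendsto.const_mul (tendsto_finsetSum (Finset.range (m + 1))
      fun n _ => hinv n) (Or.inr (A.batchRate_ne_top i m))
    simpa using h1
  have h2 := tendsto_lintegral_of_dominated_convergence (μ := Measure.count)
    (F := fun k m => A.batchRate i m *
      ∑ n ∈ Finset.range (m + 1), ((k + n : ℕ) + 1 : ℝ≥0∞)⁻¹) (f := fun _ => 0)
    (fun m => A.batchRate i m * harmonicSum (m + 1)) (fun k => measurable_of_countable _)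
    (fun k => Eventually.of_forall fun m => by
      simp only [harmonicSum]
      gcongr with n
      omega)
    (by rw [lintegral_count]; exact hi)
    (Eventually.of_forall hterm)
  simp only [lintegral_count, tsum_zero] at h2
  exact h2

lemma exists_harmonicMoment_bound (h : ∀ i, A.harmonicMoment i ≠ ∞) :
    ∃ b : ℝ≥0∞, b ≠ ∞ ∧ ∀ i k, A.arrivalDrift i k ≤ b :=
  ⟨∑ i, A.harmonicMoment i, (ENNReal.sum_lt_top.2 fun i _ => (h i).lt_top).ne, fun i k =>
    (A.arrivalDrift_le i k).trans (Finset.single_le_sum (f := A.harmonicMoment)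
      (fun _ _ => zero_le) (Finset.mem_univ i))⟩

/-- Under the moment condition the queue does not explode. -/
lemma tsum_resolventKernel_mul (hμ : 0 < μ) (h : ∀ i, A.harmonicMoment i ≠ ∞) {r : ℝ≥0∞}
    (hr0 : r ≠ 0) (hr : r ≠ ∞) (x : ℕ × Fin d) :
    ∑' y, resolventKernel (A.queueGenerator μ) r x y * r = 1 := by
  obtain ⟨b, hb, hdrift⟩ := A.exists_harmonicMoment_bound h
  have hbr : b / r ≠ ∞ := ENNReal.div_ne_top hb hr0
  refine _root_.tsum_resolventKernel_mul hr0 hr (A.isConservativeGenerator hμ)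
    (W := fun x => harmonicSum x.1 + b / r)
    (fun x => ENNReal.add_ne_top.2 ⟨harmonicSum_ne_top _, hbr⟩) (fun x => ?_) (fun c hc => ?_) x
  · obtain ⟨k, i⟩ := x
    have h1 := (A.sum_jumpRate_harmonicSum hμ k i)
    simp only [mul_add]
    rw [ENNReal.tsum_add, ENNReal.tsum_mul_right, (A.isConservativeGenerator hμ).tsum_jumpRate]
    simp only [add_mul]
    rw [ENNReal.mul_div_cancel hr0 hr]
    calc _ ≤ (exitRate (A.queueGenerator μ) (k, i) * harmonicSum k + A.arrivalDrift i k) +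
          exitRate (A.queueGenerator μ) (k, i) * (b / r) := by
          rw [← h1]
          gcongr
          exact le_self_add
      _ ≤ (exitRate (A.queueGenerator μ) (k, i) * harmonicSum k + b) +
          exitRate (A.queueGenerator μ) (k, i) * (b / r) := by
          gcongr
          exact hdrift i k
      _ ≤ r * harmonicSum k + ((exitRate (A.queueGenerator μ) (k, i) * harmonicSum k + b) +
          exitRate (A.queueGenerator μ) (k, i) * (b / r)) := le_add_self
      _ = _ := by ring
  · obtain ⟨k, hk⟩ := exists_le_harmonicSum hc
    refine Set.Finite.subset ((Finset.range k ×ˢ Finset.univ).finite_toSet) fun x hx => ?_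
    have h2 : harmonicSum x.1 < c := lt_of_le_of_lt le_self_add hx
    simp only [Finset.coe_product, Finset.coe_univ, Set.mem_prod, Set.mem_univ, and_true,
      Finset.coe_range, Set.mem_Iio]
    by_contra hlt
    exact absurd (hk.trans (harmonicSum_mono (not_lt.1 hlt))) (not_le.2 h2)

/-- At high levels the services decrease `H` at the rate `μ`, which exceeds the effect of the
arrivals. -/
lemma exists_isBalanced (hμ : 0 < μ) (h : ∀ i, A.harmonicMoment i ≠ ∞) :
    ∃ π : ℕ × Fin d → ℝ≥0∞, ∑' x, π x = 1 ∧ IsBalanced (A.queueGenerator μ) π := by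
  obtain ⟨b, hb, hdrift⟩ := A.exists_harmonicMoment_bound h
  have : Nonempty (Fin d) := by
    by_contra hd
    exact A.nontrivial (funext fun i => absurd ⟨i⟩ hd)
  set δ : ℝ≥0∞ := ENNReal.ofReal (μ / 2) with hδ
  have hδ0 : 0 < δ := ENNReal.ofReal_pos.2 (half_pos hμ)
  have hδ2 : ENNReal.ofReal μ = δ + δ := by
    rw [hδ, ← ENNReal.ofReal_add (half_pos hμ).le (half_pos hμ).le, add_halves]
  have hev : ∀ᶠ k in atTop, ∀ i, A.arrivalDrift i k < δ :=
    eventually_all.2 fun i => (tendsto_order.1 (A.tendsto_arrivalDrift (h i))).2 δ hδ0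
  obtain ⟨N, hN⟩ := eventually_atTop.1 hev
  refine _root_.exists_isBalanced (A.finite_jumpRate_ne_zero μ)
    (fun r hr0 hr x => A.tsum_resolventKernel_mul hμ h hr0 hr x)
    (V := fun x => harmonicSum x.1) (fun x => harmonicSum_ne_top _)
    (Finset.range (N + 1) ×ˢ Finset.univ) (b := δ + b) (δ := δ)
    (ENNReal.add_ne_top.2 ⟨ENNReal.ofReal_ne_top, hb⟩) hδ0.ne' fun x => ?_
  obtain ⟨k, i⟩ := x
  have h1 := A.sum_jumpRate_harmonicSum hμ k i
  by_cases hk : k < N + 1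
  · have hmem : (k, i) ∈ Finset.range (N + 1) ×ˢ (Finset.univ : Finset (Fin d)) := by
      simpa using hk
    rw [if_pos hmem, add_left_comm]
    gcongr
    calc _ ≤ exitRate (A.queueGenerator μ) (k, i) * harmonicSum k + A.arrivalDrift i k := by
          rw [← h1]
          exact le_self_add
      _ ≤ _ := by
          gcongr
          exact hdrift i k
  · have hmem : (k, i) ∉ Finset.range (N + 1) ×ˢ (Finset.univ : Finset (Fin d)) := by
      simpa using hk
    rw [if_neg hmem, add_zero]
    rw [if_neg (by omega), hδ2, ← add_assoc] at h1
    refine (ENNReal.add_le_add_iff_right (a := δ) ENNReal.ofReal_ne_top).1 ?_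
    rw [add_comm δ, h1]
    gcongr
    exact (hN k (by omega) i).le

end BMAP

theorem theorem1 {d : ℕ} (A : BMAP d) (μ : ℝ) (hμ : 0 < μ) :
    (IsErgodic (ctmcTransition (A.queueGenerator μ)) ↔ A.LogMomentCondition) ∧
    ((∃! π : ℕ × Fin d → ℝ, IsStationaryVector (A.queueGenerator μ) π) ↔
      A.LogMomentCondition) := by
  have hq := A.isConservativeGenerator hμ
  have hsuff : A.LogMomentCondition → ∃ π : ℕ × Fin d → ℝ≥0∞, ∑' x, π x = 1 ∧
      IsBalanced (A.queueGenerator μ) π ∧ IsErgodic (ctmcTransition (A.queueGenerator μ)) ∧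
      ∀ ν : ℕ × Fin d → ℝ≥0∞, ∑' x, ν x = 1 → IsBalanced (A.queueGenerator μ) ν → ν = π := by
    intro hlog
    have hmom := A.logMomentCondition_iff.1 hlog
    obtain ⟨π, hπ1, hπ⟩ := A.exists_isBalanced hμ hmom
    refine ⟨π, hπ1, hπ, isErgodic_of_isBalanced hq (A.reach hμ) (fun x => ?_) hπ1 hπ⟩
    simpa using A.tsum_resolventKernel_mul hμ hmom one_ne_zero ENNReal.one_ne_top x
  refine ⟨⟨fun ⟨π, hπ, _⟩ => ?_, fun hlog => ?_⟩, ⟨fun ⟨π, hπ, _⟩ => ?_, fun hlog => ?_⟩⟩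
  · exact A.logMomentCondition_of_isBalanced hμ hπ.1 (IsBalanced.of_resolventKernel hπ.1
      (tsum_mul_resolventKernel_of_stationary hq.diag_nonpos hπ))
  · obtain ⟨π, -, -, herg, -⟩ := hsuff hlog
    exact herg
  · obtain ⟨h1, hbal⟩ := hπ.isBalanced hq
    exact A.logMomentCondition_of_isBalanced hμ h1 hbal
  · obtain ⟨π, hπ1, hπ, -, huniq⟩ := hsuff hlog
    refine ⟨fun x => (π x).toReal, hπ.isStationaryVector hq hπ1, fun ν hν => ?_⟩
    obtain ⟨h1, hbal⟩ := hν.isBalanced hq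
    funext x
    rw [← huniq _ h1 hbal, ENNReal.toReal_ofReal (hν.1 x)]
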